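/- Let $M\subset\mathbb R^{2n}$ be an open set containing the origin, with points $z=(q,p)$ and Euclidean norm $\|\cdot\|$. Put $I_j(q,p)=\frac{p_j^2+q_j^2}{2}$ and let $H=H_0+P$ on $M$, where $H_0=\sum_{j=1}^n\omega_jI_j$ with $\omega\in\mathbb R^n$, and $P\in C^\infty(M,\mathbb R)$ satisfies $P(z)=O(\|z\|^3)$ as $z\to0$. Assume that $\omega$ is non-resonant, i.e. $\sum_{j}k_j\omega_j\neq0$ for all $k\in\mathbb Z^n\setminus\{0\}$. Then for every integer $r\ge3$ there exist $\varepsilon_0>0$, $C>0$ and a real analytic canonical transformation (a diffeomorphism with real analytic inverse that preserves the Poisson bracket) $\tau:\mathcal U\to\mathcal V$ between open neighbourhoods $\mathcal U,\mathcal V\subset M$ of the origin, with $\tau(z')=z'+O(\|z'\|^2)$, which puts $H$ in Birkhoff normal form up to order $r$, that is $$H\circ\tau=H_0+Z+R,$$ where $Z$ is a polynomial of degree at most $r$ in $z'$ that depends only on the actions $I_1(z'),\dots,I_n(z')$, and $R(z')=O(\|z'\|^{r+1})$; and these can be chosen such that the following holds for every $z_0=(q_0,p_0)$ with $\|z_0\|=\varepsilon<\varepsilon_0$.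 The point $z_0$ lies in $\mathcal V$, the torus $\{z'\in\mathbb R^{2n}: I_j(z')=I_j(\tau^{-1}(z_0)),\ j=1,\dots,n\}$ (a product of $n$ circles, some of which may be reduced to points) is contained in $\mathcal U$, and its image $$\mathcal T_0=\{z\in\mathcal V:\ I_j(\tau^{-1}(z))=I_j(\tau^{-1}(z_0)),\ j=1,\dots,n\}\subset M$$ satisfies, for all real $r_1\ge0$ and $r_2$ with $r_1+r_2=r+1$: the solution $(q(t),p(t))$ of the Hamiltonian system $\dot q_j=\partial H/\partial p_j$, $\dot p_j=-\partial H/\partial q_j$ with $(q(0),p(0))=(q_0,p_0)$ exists in $M$ for $|t|\le 1/\varepsilon^{r_2}$, and $$\operatorname{dist}\big((q(t),p(t)),\mathcal T_0\big)\le C\,\varepsilon^{r_1}\qquad\text{for } |t|\le \frac1{\varepsilon^{r_2}}.$$ -/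

import Mathlib

open scoped Topology

noncomputable section

namespace Birkhoff

/-- The space `ℝ²ⁿ` with its Euclidean norm; `z (Sum.inl j)` is the position `q_j` and
`z (Sum.inr j)` is the momentum `p_j` of the point `z = (q, p)`. -/
abbrev Phase (n : ℕ) : Type := EuclideanSpace ℝ (Fin n ⊕ Fin n)

variable {n : ℕ}

/-- The partial derivative `∂F/∂q_j` at `z`. -/
def dq (F : Phase n → ℝ) (j : Fin n) (z : Phase n) : ℝ :=
  fderiv ℝ F z (EuclideanSpace.single (Sum.inl j) 1)

/-- The partial derivative `∂F/∂p_j` at `z`. -/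
def dp (F : Phase n → ℝ) (j : Fin n) (z : Phase n) : ℝ :=
  fderiv ℝ F z (EuclideanSpace.single (Sum.inr j) 1)

/-- The Hamiltonian vector field `X_H = (∂H/∂p, -∂H/∂q)`. -/
def hamVectorField (H : Phase n → ℝ) (z : Phase n) : Phase n :=
  WithLp.toLp 2 (Sum.elim (fun j => dp H j z) (fun j => -dq H j z))

/-- The Poisson bracket `{F, G}`. -/
def poissonBracket (F G : Phase n → ℝ) (z : Phase n) : ℝ :=
  ∑ j, (dq F j z * dp G j z - dp F j z * dq G j z)

/-- The `j`-th action `I_j = (p_j² + q_j²) / 2`. -/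
def action (j : Fin n) (z : Phase n) : ℝ :=
  (z (Sum.inr j) ^ 2 + z (Sum.inl j) ^ 2) / 2

/-- The harmonic oscillator `H₀ = ∑ ω_j I_j`. -/
def harmonic (ω : Fin n → ℝ) (z : Phase n) : ℝ :=
  ∑ j, ω j * action j z

/-- The torus `T_a`: the points of `ℝ²ⁿ` with actions `a`, a product of `n` circles
(a circle of radius `0` being a point). -/
def actionTorus (a : Fin n → ℝ) : Set (Phase n) :=
  {z | ∀ j, action j z = a j}

/-- A frequency vector is non resonant if it has no non-trivial integer relation. -/
def NonResonant (ω : Fin n → ℝ) : Prop :=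
  ∀ k : Fin n → ℤ, k ≠ 0 → ∑ j, (k j : ℝ) * ω j ≠ 0

/-- `z` solves the Hamiltonian system of `H` on the set of times `J`, inside the phase space
`M`. -/
def IsSolutionOn (M : Set (Phase n)) (H : Phase n → ℝ) (J : Set ℝ) (z : ℝ → Phase n) : Prop :=
  ∀ t ∈ J, z t ∈ M ∧ HasDerivWithinAt z (hamVectorField H (z t)) J t

/-- A real analytic canonical transformation from the open set `τ.source` onto the open set
`τ.target`. -/
structure IsAnalyticCanonical (τ : OpenPartialHomeomorph (Phase n) (Phase n)) : Prop where
  analytic : AnalyticOnNhd ℝ τ τ.source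
  analytic_symm : AnalyticOnNhd ℝ τ.symm τ.target
  bracket : ∀ F G : Phase n → ℝ, ContDiffOn ℝ (⊤ : ℕ∞) F τ.target → ContDiffOn ℝ (⊤ : ℕ∞) G τ.target →
    ∀ z ∈ τ.source, poissonBracket (F ∘ τ) (G ∘ τ) z = poissonBracket F G (τ z)

/-- `τ` is a real analytic canonical transformation between neighbourhoods of the origin in `M`,
close to the identity, which puts `H = H₀ + P` into non-resonant Birkhoff normal form up to
order `r`: `H ∘ τ = H₀ + Z + R`, with `Z` a polynomial of degree at most `r` in `(q, p)` that
depends on the actions only, and `R = O(‖z‖ ^ (r + 1))`. -/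
structure IsNormalizing (M : Set (Phase n)) (ω : Fin n → ℝ) (P : Phase n → ℝ) (r : ℕ)
    (τ : OpenPartialHomeomorph (Phase n) (Phase n)) : Prop where
  zero_mem_source : 0 ∈ τ.source
  zero_mem_target : 0 ∈ τ.target
  source_subset : τ.source ⊆ M
  target_subset : τ.target ⊆ M
  canonical : IsAnalyticCanonical τ
  near_id : (fun z => τ z - z) =O[𝓝 0] fun z => ‖z‖ ^ 2
  normal_form : ∃ Z : MvPolynomial (Fin n) ℝ, 2 * Z.totalDegree ≤ r ∧
    (fun z => (harmonic ω + P) (τ z)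
        - (harmonic ω z + MvPolynomial.eval (fun j => action j z) Z))
      =O[𝓝 0] fun z => ‖z‖ ^ (r + 1)

/-- The torus through `z₀` on which the normalized actions `I_j ∘ τ⁻¹` are those of `z₀`. -/
def normalizedTorus (τ : OpenPartialHomeomorph (Phase n) (Phase n)) (z₀ : Phase n) :
    Set (Phase n) :=
  {z | z ∈ τ.target ∧ ∀ j, action j (τ.symm z) = action j (τ.symm z₀)}

end Birkhoff

end

namespace Birkhoff

open Asymptotics Filter

/-! Normal form. In the coordinates q_j ± i p_j the derivation along the harmonic field is diagonal
on monomials, and non-resonance reduces its kernel to the polynomials in the actions. Hence every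
homogeneous f of degree m is a bracket of some G with H₀ plus a polynomial in the actions
(`hasHomologicalSolution`). The generator G is not integrated as a flow: by polarization it is a
combination of powers ℓ^m of linear forms, and each such power generates the explicit polynomial
shear z + c ℓ(z)^(m-1) X_ℓ, which is symplectic with polynomial inverse. Composing shears realizes G
modulo degree m + 1 (`exists_canonical_generated`), and induction on the degree
(`exists_normalization`) yields a symplectic e, analytic on the whole space together with its
inverse, such that H ∘ e = Φ(I) + R with R of order N + 1.

Stability. Since Φ(I) commutes with the actions, I_j ∘ e⁻¹ is driven by {I_j, R} alone. This bracket
is bounded by √I_j ‖dR‖ up to a constant, so the radii √(2 I_j), and not merely the actions, move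
with speed O(ε^N), even where a circle shrinks to a point. The distance to the torus is at most the
sum of the changes of the radii. A bootstrap (`norm_lt_of_short_time`) keeps the orbit in the ball
of radius 7ε meanwhile. To close it up to time ε^(-(r+1)) the Hamiltonian is normalized to order N =
r + 3, and the extra action terms are then counted as part of the order r remainder. Solutions exist
because those of a compactly cut-off field are global and, by the same bootstrap, stay where the
cut-off is 1. -/

theorem isBigO_norm_pow_of_le {E : Type*} [NormedAddCommGroup E] {m k : ℕ} (h : m ≤ k) :
    (fun z : E => ‖z‖ ^ k) =O[𝓝 0] fun z => ‖z‖ ^ m := by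
  refine IsBigO.of_bound 1 ?_
  filter_upwards [Metric.ball_mem_nhds (0 : E) one_pos] with z hz
  rw [mem_ball_zero_iff] at hz
  simpa using pow_le_pow_of_le_one (norm_nonneg z) hz.le h

/-! ### Homogeneous polynomials as combinations of powers of linear forms. -/

section PowerSpan

variable {E : Type*} [NormedAddCommGroup E] [NormedSpace ℝ E]

/-- The span of the `m`-th powers of continuous linear forms. In finite dimension these are the
homogeneous polynomial functions of degree `m`. -/
def powerSpan (E : Type*) [NormedAddCommGroup E] [NormedSpace ℝ E] (m : ℕ) :
    Submodule ℝ (E → ℝ) :=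
  Submodule.span ℝ (Set.range fun (ℓ : E →L[ℝ] ℝ) (z : E) => ℓ z ^ m)

theorem pow_mem_powerSpan (ℓ : E →L[ℝ] ℝ) (m : ℕ) : (fun z => ℓ z ^ m) ∈ powerSpan E m :=
  Submodule.subset_span ⟨ℓ, rfl⟩

/-- Polarization: the product of a linear form and an `m`-th power of a linear form is a
combination of `m + 1`-st powers. -/
theorem linear_mul_pow_mem (x y : E →L[ℝ] ℝ) (m : ℕ) :
    (fun z => x z * y z ^ m) ∈ powerSpan E (m + 1) := by
  -- A functional φ vanishing on all powers kills (t x + y)^(m+1) for every t. As a polynomial in t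
  -- this is `p`, whose coefficient of t is (m + 1) φ(x y^m), so φ cannot separate x y^m from the
  -- span.
  by_contra hv
  obtain ⟨φ, hφ, hker⟩ := Submodule.exists_le_ker_of_notMem hv
  let p : Polynomial ℝ := ∑ j ∈ Finset.range (m + 2),
    Polynomial.monomial j
      (φ (fun z => x z ^ j * y z ^ (m + 1 - j) * ((m + 1).choose j : ℝ)))
  have hp : p = 0 := by
    refine Polynomial.funext fun t => ?_
    have h : (fun z => (t • x + y) z ^ (m + 1)) ∈ powerSpan E (m + 1) := pow_mem_powerSpan _ _
    have h0 := hker h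
    rw [LinearMap.mem_ker] at h0
    rw [Polynomial.eval_zero, ← h0, Polynomial.eval_finsetSum]
    have : (fun z => (t • x + y) z ^ (m + 1)) = ∑ j ∈ Finset.range (m + 2),
        t ^ j • (fun z => x z ^ j * y z ^ (m + 1 - j) * ((m + 1).choose j : ℝ)) := by
      funext z
      simp [add_pow, mul_pow, Finset.sum_apply]
      refine Finset.sum_congr rfl fun j _ => by ring
    rw [this, map_sum]
    refine Finset.sum_congr rfl fun j _ => ?_
    rw [map_smul, Polynomial.eval_monomial, smul_eq_mul, mul_comm]
  have h1 : p.coeff 1 = φ (fun z => x z ^ 1 * y z ^ (m + 1 - 1) * ((m + 1).choose 1 : ℝ)) := by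
    simp [p, Polynomial.coeff_monomial]
  rw [hp, Polynomial.coeff_zero] at h1
  have h2 : (fun z => x z ^ 1 * y z ^ (m + 1 - 1) * ((m + 1).choose 1 : ℝ)) =
      ((m : ℝ) + 1) • (fun z => x z * y z ^ m) := by
    funext z
    simp
    ring
  rw [h2, map_smul, smul_eq_mul] at h1
  have : (m : ℝ) + 1 ≠ 0 := by positivity
  exact hφ ((mul_eq_zero.1 h1.symm).resolve_left this)

theorem linear_mul_mem (x : E →L[ℝ] ℝ) {m : ℕ} {f : E → ℝ} (hf : f ∈ powerSpan E m) :
    (fun z => x z * f z) ∈ powerSpan E (m + 1) := by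
  induction hf using Submodule.span_induction with
  | mem f hf => obtain ⟨y, rfl⟩ := hf; exact linear_mul_pow_mem x y m
  | zero => simp only [Pi.zero_apply, mul_zero]; exact (powerSpan E (m + 1)).zero_mem
  | add f g _ _ hf hg =>
    convert add_mem hf hg using 1
    funext z
    simp [mul_add]
  | smul a f _ hf =>
    convert (powerSpan E (m + 1)).smul_mem a hf using 1
    funext z
    simp
    ring

theorem mul_mem_powerSpan {m k : ℕ} {f g : E → ℝ} (hf : f ∈ powerSpan E m)
    (hg : g ∈ powerSpan E k) : (fun z => f z * g z) ∈ powerSpan E (m + k) := by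
  induction hf using Submodule.span_induction with
  | mem f hf =>
    obtain ⟨y, rfl⟩ := hf
    induction m with
    | zero => simpa using hg
    | succ m ih =>
      convert linear_mul_mem y ih using 1
      · ring_nf
      · funext z
        ring
  | zero => simp only [Pi.zero_apply, zero_mul]; exact (powerSpan E (m + k)).zero_mem
  | add f g _ _ hf hg =>
    convert add_mem hf hg using 1
    funext z
    simp [add_mul]
  | smul a f _ hf =>
    convert (powerSpan E (m + k)).smul_mem a hf using 1
    funext z
    simp
    ring

theorem const_mem_powerSpan (c : ℝ) : (fun _ => c) ∈ powerSpan E 0 := by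
  convert (powerSpan E 0).smul_mem c (pow_mem_powerSpan (0 : E →L[ℝ] ℝ) 0) using 1
  funext z
  simp

theorem powerSpan_smul {m : ℕ} {f : E → ℝ} (hf : f ∈ powerSpan E m) (t : ℝ) (z : E) :
    f (t • z) = t ^ m * f z := by
  induction hf using Submodule.span_induction with
  | mem f hf => obtain ⟨y, rfl⟩ := hf; simp [mul_pow]
  | zero => simp
  | add f g _ _ hf hg => simp [hf, hg, mul_add]
  | smul a f _ hf => simp [hf]; ring

theorem contDiff_of_mem_powerSpan {m : ℕ} {f : E → ℝ} (hf : f ∈ powerSpan E m)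
    {k : WithTop ℕ∞} : ContDiff ℝ k f := by
  induction hf using Submodule.span_induction with
  | mem f hf => obtain ⟨y, rfl⟩ := hf; exact y.contDiff.pow m
  | zero => exact contDiff_const
  | add f g _ _ hf hg => exact hf.add hg
  | smul a f _ hf => exact contDiff_const.smul hf

theorem isBigO_of_mem_powerSpan {m : ℕ} {f : E → ℝ} (hf : f ∈ powerSpan E m) (l : Filter E) :
    f =O[l] fun z => ‖z‖ ^ m := by
  induction hf using Submodule.span_induction with
  | mem f hf =>
    obtain ⟨y, rfl⟩ := hf
    exact (y.isBigO_id l).norm_right.pow m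
  | zero => exact isBigO_zero _ _
  | add f g _ _ hf hg => exact hf.add hg
  | smul a f _ hf => exact hf.const_smul_left a

theorem fderiv_isBigO_of_mem_powerSpan {m : ℕ} {f : E → ℝ} (hf : f ∈ powerSpan E (m + 1))
    (l : Filter E) : fderiv ℝ f =O[l] fun z => ‖z‖ ^ m := by
  induction hf using Submodule.span_induction with
  | mem f hf =>
    obtain ⟨y, rfl⟩ := hf
    have : fderiv ℝ (fun z => y z ^ (m + 1)) = fun z => (((m + 1 : ℕ) : ℝ) * y z ^ m) • y := by
      funext z
      simpa using ((y.hasFDerivAt (x := z)).pow (m + 1)).fderiv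
    simp only [this]
    have h1 : (fun z => ((m + 1 : ℕ) : ℝ) * y z ^ m) =O[l] fun z => ‖z‖ ^ m :=
      ((y.isBigO_id l).norm_right.pow m).const_mul_left _
    have h2 : (fun _ : E => y) =O[l] fun _ => (1 : ℝ) := isBigO_const_const y one_ne_zero l
    simpa using h1.smul h2
  | zero => simpa [Pi.zero_def] using isBigO_zero _ _
  | add f g hf' hg' hf hg =>
    have : fderiv ℝ (f + g) = fderiv ℝ f + fderiv ℝ g := by
      funext z
      exact fderiv_add ((contDiff_of_mem_powerSpan hf' (k := 1)).differentiable one_ne_zero z)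
        ((contDiff_of_mem_powerSpan hg' (k := 1)).differentiable one_ne_zero z)
    rw [this]
    exact hf.add hg
  | smul a f hf' hf =>
    have : fderiv ℝ (a • f) = a • fderiv ℝ f := by
      funext z
      exact fderiv_const_smul
        ((contDiff_of_mem_powerSpan hf' (k := 1)).differentiable one_ne_zero z) a
    rw [this]
    exact hf.const_smul_left a

/-- Along the ray t z the function scales like t^m while the bound scales like t^(m+1); divide by
t^m and let t tend to 0. -/
theorem eq_zero_of_mem_powerSpan {m : ℕ} {f : E → ℝ} (hf : f ∈ powerSpan E m)
    (h : f =O[𝓝 0] fun z => ‖z‖ ^ (m + 1)) : f = 0 := by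
  funext z
  obtain ⟨C, hC⟩ := h.bound
  have ht : Tendsto (fun t : ℝ => t • z) (𝓝[>] 0) (𝓝 0) := by
    have : Continuous fun t : ℝ => t • z := by fun_prop
    simpa using (this.tendsto 0).mono_left nhdsWithin_le_nhds
  have h1 : ∀ᶠ t : ℝ in 𝓝[>] 0, |f z| ≤ C * ‖z‖ ^ (m + 1) * t := by
    filter_upwards [ht.eventually hC, self_mem_nhdsWithin] with t h1 (ht0 : 0 < t)
    rw [powerSpan_smul hf, norm_smul, norm_mul, norm_pow, norm_pow, norm_mul, norm_norm,
      Real.norm_of_nonneg ht0.le, Real.norm_eq_abs, mul_pow, pow_succ t, norm_norm] at h1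
    have h2 : 0 < t ^ m := by positivity
    refine le_of_mul_le_mul_left (h1.trans_eq ?_) h2
    ring
  have h2 : Tendsto (fun t : ℝ => C * ‖z‖ ^ (m + 1) * t) (𝓝[>] 0) (𝓝 0) := by
    have : Continuous fun t : ℝ => C * ‖z‖ ^ (m + 1) * t := by fun_prop
    simpa using (this.tendsto 0).mono_left nhdsWithin_le_nhds
  exact abs_eq_zero.1 (le_antisymm (ge_of_tendsto h2 h1) (abs_nonneg _))

/-- If a sum of homogeneous polynomials of degrees `< k` is `O(‖z‖ ^ k)`, they all vanish. -/
theorem eq_zero_of_sum_isBigO {T : ℕ → E → ℝ} (hT : ∀ j, T j ∈ powerSpan E j) (k : ℕ)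
    (h : (fun z => ∑ j ∈ Finset.range k, T j z) =O[𝓝 0] fun z => ‖z‖ ^ k) :
    ∀ j < k, T j = 0 := by
  induction k with
  | zero => simp
  | succ k ih =>
    have h1 : ∀ j < k, T j = 0 := by
      refine ih ?_
      have := (h.trans (isBigO_norm_pow_of_le k.le_succ)).sub
        (isBigO_of_mem_powerSpan (hT k) (𝓝 0))
      refine this.congr_left fun z => ?_
      rw [Finset.sum_range_succ, add_sub_cancel_right]
    have h2 : T k = 0 := by
      refine eq_zero_of_mem_powerSpan (hT k) (h.congr_left fun z => ?_)
      rw [Finset.sum_range_succ, Finset.sum_eq_zero, zero_add]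
      intro j hj
      rw [h1 j (Finset.mem_range.1 hj), Pi.zero_apply]
    intro j hj
    rcases Nat.lt_succ_iff_lt_or_eq.1 hj with h | rfl
    exacts [h1 j h, h2]

end PowerSpan

/-! ### Taylor expansion into homogeneous polynomials. -/

section Taylor

variable {ι : Type*} [Fintype ι] [DecidableEq ι]

/-- Taylor expansion of a smooth function at the origin. -/
theorem exists_taylor (k : ℕ) : ∀ {f : EuclideanSpace ℝ ι → ℝ},
    ContDiffAt ℝ (⊤ : ℕ∞) f 0 →
    ∃ T : ℕ → EuclideanSpace ℝ ι → ℝ, (∀ j, T j ∈ powerSpan (EuclideanSpace ℝ ι) j) ∧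
      (fun z => f z - ∑ j ∈ Finset.range k, T j z) =O[𝓝 0] fun z => ‖z‖ ^ k := by
  induction k with
  | zero =>
    intro f hf
    refine ⟨fun _ => 0, fun j => Submodule.zero_mem _, ?_⟩
    simpa using hf.continuousAt.isBigO_one ℝ
  | succ k ih =>
    intro f hf
    have hd : ∀ i, ContDiffAt ℝ (⊤ : ℕ∞)
        (fun z => fderiv ℝ f z (EuclideanSpace.single i 1)) 0 := fun i =>
      (hf.fderiv_right (m := (⊤ : ℕ∞)) le_rfl).clm_apply contDiffAt_const
    choose T hT hTO using fun i => ih (hd i)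
    -- Euler's identity: the degree j terms of the partial derivatives, integrated along the ray t
    -- z, contribute the factor 1/(j + 1).
    let S : ℕ → EuclideanSpace ℝ ι → ℝ := fun j => match j with
      | 0 => fun _ => f 0
      | j + 1 => fun z => ((j : ℝ) + 1)⁻¹ * ∑ i, z i * T i j z
    refine ⟨S, ?_, ?_⟩
    · rintro (_ | j)
      · exact const_mem_powerSpan (f 0)
      · have h : ∀ i, (fun z => z i * T i j z) ∈ powerSpan (EuclideanSpace ℝ ι) (j + 1) := fun i =>
          linear_mul_mem (EuclideanSpace.proj i : EuclideanSpace ℝ ι →L[ℝ] ℝ) (hT i j)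
        convert (powerSpan _ (j + 1)).smul_mem ((j : ℝ) + 1)⁻¹
          (Submodule.sum_mem _ fun i (_ : i ∈ Finset.univ) => h i) using 1
        funext z
        simp [S, Finset.sum_apply]
    · have hsum : (fun z => ∑ i, ‖fderiv ℝ f z (EuclideanSpace.single i 1)
          - ∑ j ∈ Finset.range k, T i j z‖) =O[𝓝 0] fun z => ‖z‖ ^ k :=
        IsBigO.fun_sum fun i _ => (hTO i).norm_left
      obtain ⟨C, hC0, hC⟩ := hsum.exists_pos
      rw [IsBigOWith] at hC
      have hdiff : ∀ᶠ z in 𝓝 (0 : EuclideanSpace ℝ ι), DifferentiableAt ℝ f z :=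
        ((hf.of_le (m := 1) (by simp)).eventually (by simp)).mono
          fun z hz => hz.differentiableAt one_ne_zero
      obtain ⟨δ, hδ, hball⟩ := Metric.eventually_nhds_iff_ball.1 (hC.and hdiff)
      refine IsBigO.of_bound C ?_
      filter_upwards [Metric.ball_mem_nhds 0 hδ] with z hz
      rw [mem_ball_zero_iff] at hz
      have hmem : ∀ t ∈ Set.Icc (0 : ℝ) 1, t • z ∈ Metric.ball (0 : EuclideanSpace ℝ ι) δ := by
        intro t ht
        rw [mem_ball_zero_iff, norm_smul, Real.norm_of_nonneg ht.1]
        nlinarith [ht.2, norm_nonneg z]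
      -- `g 1 - g 0` is the Taylor remainder at z, and `g'` is built from the remainders of the
      -- partial derivatives, each O(‖z‖^k); the coordinate factor z i supplies the missing power.
      let g : ℝ → ℝ := fun t => f (t • z) - ∑ j ∈ Finset.range k, t ^ (j + 1) * S (j + 1) z
      let g' : ℝ → ℝ := fun t => ∑ i, z i * (fderiv ℝ f (t • z) (EuclideanSpace.single i 1)
          - ∑ j ∈ Finset.range k, T i j (t • z))
      have hg : ∀ t ∈ Set.Icc (0 : ℝ) 1, HasDerivWithinAt g (g' t) (Set.Icc 0 1) t := by
        intro t ht
        have h1 : HasDerivAt (fun t : ℝ => f (t • z)) (fderiv ℝ f (t • z) z) t := by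
          have h2 := (hball _ (hmem t ht)).2.hasFDerivAt
          have h3 : HasDerivAt (fun t : ℝ => t • z) z t := by
            simpa using (hasDerivAt_id t).smul_const z
          exact h2.comp_hasDerivAt t h3
        have h4 : HasDerivAt (fun t : ℝ => ∑ j ∈ Finset.range k, t ^ (j + 1) * S (j + 1) z)
            (∑ j ∈ Finset.range k, ((j + 1 : ℕ) : ℝ) * t ^ j * S (j + 1) z) t := by
          refine HasDerivAt.fun_sum fun j _ => ?_
          simpa using (hasDerivAt_pow (j + 1) t).mul_const (S (j + 1) z)
        refine ((h1.sub h4).congr_deriv ?_).hasDerivWithinAt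
        have hz' : fderiv ℝ f (t • z) z
            = ∑ i, z i * fderiv ℝ f (t • z) (EuclideanSpace.single i 1) := by
          have h := congrArg (fderiv ℝ f (t • z)) ((EuclideanSpace.basisFun ι ℝ).sum_repr z)
          rw [map_sum] at h
          simpa using h.symm
        simp only [g', mul_sub, Finset.sum_sub_distrib, hz']
        congr 1
        simp only [Finset.mul_sum]
        rw [Finset.sum_comm]
        refine Finset.sum_congr rfl fun j _ => ?_
        simp only [S]
        have : ((j + 1 : ℕ) : ℝ) * t ^ j * (((j : ℝ) + 1)⁻¹ * ∑ i, z i * T i j z)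
            = t ^ j * ∑ i, z i * T i j z := by
          push_cast
          field_simp
        rw [this, Finset.mul_sum]
        refine Finset.sum_congr rfl fun i _ => ?_
        rw [powerSpan_smul (hT i j)]
        ring
      have hb : ∀ t ∈ Set.Ico (0 : ℝ) 1, ‖g' t‖ ≤ C * ‖z‖ ^ (k + 1) := by
        intro t ht
        have h1 := (hball _ (hmem t ⟨ht.1, ht.2.le⟩)).1
        rw [Real.norm_of_nonneg (Finset.sum_nonneg fun i _ => norm_nonneg _), norm_pow,
          norm_norm] at h1
        have h2 : ‖t • z‖ ≤ ‖z‖ := by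
          rw [norm_smul, Real.norm_of_nonneg ht.1]
          nlinarith [ht.2, norm_nonneg z]
        calc ‖g' t‖ ≤ ∑ i, ‖z‖ * ‖fderiv ℝ f (t • z) (EuclideanSpace.single i 1)
              - ∑ j ∈ Finset.range k, T i j (t • z)‖ := by
              refine norm_sum_le_of_le _ fun i _ => ?_
              rw [norm_mul]
              gcongr
              exact PiLp.norm_apply_le z i
          _ ≤ ‖z‖ * (C * ‖t • z‖ ^ k) := by
              rw [← Finset.mul_sum]
              gcongr
          _ ≤ ‖z‖ * (C * ‖z‖ ^ k) := by gcongr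
          _ = C * ‖z‖ ^ (k + 1) := by ring
      have := norm_image_sub_le_of_norm_deriv_le_segment_01' hg hb
      have heq : g 1 - g 0 = f z - ∑ j ∈ Finset.range (k + 1), S j z := by
        rw [Finset.sum_range_succ']
        simp [g, S]
        ring
      rw [heq] at this
      simpa using this

/-- The leading homogeneous part of a smooth function of order `m` at the origin. -/
theorem exists_leading_part {m : ℕ} {f : EuclideanSpace ℝ ι → ℝ}
    (hf : ContDiffAt ℝ (⊤ : ℕ∞) f 0) (hO : f =O[𝓝 0] fun z => ‖z‖ ^ m) (N : ℕ) (hN : m ≤ N) :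
    ∃ T : ℕ → EuclideanSpace ℝ ι → ℝ, (∀ j, T j ∈ powerSpan (EuclideanSpace ℝ ι) j) ∧
      (∀ j < m, T j = 0) ∧
      (fun z => f z - ∑ j ∈ Finset.Ico m N, T j z) =O[𝓝 0] fun z => ‖z‖ ^ N := by
  obtain ⟨T, hT, hTO⟩ := exists_taylor N hf
  have hzero : ∀ j < m, T j = 0 := by
    refine eq_zero_of_sum_isBigO hT m ?_
    have h1 : (fun z => ∑ j ∈ Finset.Ico m N, T j z) =O[𝓝 0]
        fun z : EuclideanSpace ℝ ι => ‖z‖ ^ m :=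
      IsBigO.fun_sum fun j hj => (isBigO_of_mem_powerSpan (hT j) _).trans
        (isBigO_norm_pow_of_le (Finset.mem_Ico.1 hj).1)
    refine ((hO.sub (hTO.trans (isBigO_norm_pow_of_le hN))).sub h1).congr_left fun z => ?_
    rw [← Finset.sum_range_add_sum_Ico (fun j => T j z) hN]
    ring
  refine ⟨T, hT, hzero, hTO.congr_left fun z => ?_⟩
  rw [← Finset.sum_range_add_sum_Ico (fun j => T j z) hN, Finset.sum_eq_zero, zero_add]
  intro j hj
  rw [hzero j (Finset.mem_range.1 hj), Pi.zero_apply]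

end Taylor

/-! ### Order of vanishing of derivatives. -/

section Derivative

variable {E : Type*} [NormedAddCommGroup E] [NormedSpace ℝ E]

/-- A `C²` function of order `2k` has a derivative of order at least `k`. -/
theorem fderiv_isBigO_half {f : E → ℝ} {k : ℕ} (hk : 1 ≤ k) (hf : ContDiffAt ℝ 2 f 0)
    (hO : f =O[𝓝 0] fun z => ‖z‖ ^ (2 * k)) : fderiv ℝ f =O[𝓝 0] fun z => ‖z‖ ^ k := by
  obtain ⟨K, s, hs, hK⟩ := (hf.fderiv_right (m := 1) (by norm_num)).exists_lipschitzOnWith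
  obtain ⟨C, hC0, hC⟩ := hO.exists_pos
  rw [IsBigOWith] at hC
  have hdiff : ∀ᶠ z in 𝓝 (0 : E), DifferentiableAt ℝ f z :=
    (hf.eventually (by simp)).mono fun z hz => hz.differentiableAt two_ne_zero
  obtain ⟨δ, hδ, hball⟩ := Metric.eventually_nhds_iff_ball.1 ((hC.and hdiff).and hs)
  have hzero : fderiv ℝ f 0 = 0 := by
    refine (IsBigO.hasFDerivAt (n := 2 * k) ?_ (by omega)).fderiv
    simpa using hO
  refine IsBigO.of_bound (C * 2 ^ (2 * k) + C + K) ?_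
  filter_upwards [Metric.ball_mem_nhds 0 (show 0 < min 1 (δ / 2) by positivity)] with z hz
  rw [mem_ball_zero_iff, lt_min_iff] at hz
  rw [norm_pow, norm_norm]
  refine ContinuousLinearMap.opNorm_le_bound _ (by positivity) fun v => ?_
  rcases eq_or_ne z 0 with rfl | hz0
  · rw [hzero]
    simp only [zero_apply, norm_zero]
    positivity
  rcases eq_or_ne v 0 with rfl | hv0
  · simp
  have hzp : 0 < ‖z‖ := norm_pos_iff.2 hz0
  have hvp : 0 < ‖v‖ := norm_pos_iff.2 hv0
  -- The increment has length ‖z‖^k, which balances the two errors: the values of f contribute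
  -- ‖z‖^(2k) / ‖z‖^k, and the Lipschitz variation of the derivative over the step contributes
  -- ‖z‖^k.
  set c : ℝ := ‖z‖ ^ k / ‖v‖ with hc
  have hcp : 0 < c := by positivity
  have hh : ‖c • v‖ = ‖z‖ ^ k := by
    rw [norm_smul, Real.norm_of_nonneg hcp.le, hc]
    field_simp
  have hkle : ‖z‖ ^ k ≤ ‖z‖ := by
    simpa using pow_le_pow_of_le_one hzp.le hz.1.le hk
  have hzh : ‖z + c • v‖ ≤ 2 * ‖z‖ := by
    refine (norm_add_le _ _).trans ?_
    rw [hh]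
    linarith
  have hball' : ∀ x ∈ Metric.closedBall z (‖z‖ ^ k), x ∈ Metric.ball (0 : E) δ := by
    intro x hx
    rw [mem_closedBall_iff_norm] at hx
    rw [mem_ball_zero_iff]
    have : ‖x‖ ≤ ‖x - z‖ + ‖z‖ := by simpa using norm_add_le (x - z) z
    linarith
  have hmean : ‖f (z + c • v) - f z - fderiv ℝ f z (z + c • v - z)‖
      ≤ K * ‖z‖ ^ k * ‖z + c • v - z‖ := by
    refine Convex.norm_image_sub_le_of_norm_hasFDerivWithin_le' (𝕜 := ℝ) (f' := fderiv ℝ f)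
      (s := Metric.closedBall z (‖z‖ ^ k)) (fun x hx => ?_) (fun x hx => ?_)
      (convex_closedBall _ _) (Metric.mem_closedBall_self (by positivity)) ?_
    · exact (hball x (hball' x hx)).1.2.hasFDerivAt.hasFDerivWithinAt
    · refine (hK.norm_sub_le ?_ ?_).trans ?_
      · exact (hball x (hball' x hx)).2
      · exact (hball z (hball' z (Metric.mem_closedBall_self (by positivity)))).2
      · gcongr
        exact mem_closedBall_iff_norm.1 hx
    · rw [mem_closedBall_iff_norm, add_sub_cancel_left, hh]
  rw [add_sub_cancel_left, hh, map_smul, smul_eq_mul] at hmean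
  have h1 : ‖f (z + c • v)‖ ≤ C * 2 ^ (2 * k) * (‖z‖ ^ k) ^ 2 := by
    have h := (hball (z + c • v) (hball' _ (by
      rw [mem_closedBall_iff_norm, add_sub_cancel_left, hh]))).1.1
    rw [norm_pow, norm_norm] at h
    calc ‖f (z + c • v)‖ ≤ C * ‖z + c • v‖ ^ (2 * k) := h
      _ ≤ C * (2 * ‖z‖) ^ (2 * k) := by gcongr
      _ = C * 2 ^ (2 * k) * (‖z‖ ^ k) ^ 2 := by ring
  have h2 : ‖f z‖ ≤ C * (‖z‖ ^ k) ^ 2 := by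
    have h := (hball z (hball' z (Metric.mem_closedBall_self (by positivity)))).1.1
    rw [norm_pow, norm_norm] at h
    calc ‖f z‖ ≤ C * ‖z‖ ^ (2 * k) := h
      _ = C * (‖z‖ ^ k) ^ 2 := by ring
  have h3 : ‖c * fderiv ℝ f z v‖ ≤ ‖f (z + c • v)‖ + ‖f z‖
      + ‖f (z + c • v) - f z - c * fderiv ℝ f z v‖ := by
    have e : c * fderiv ℝ f z v
        = f (z + c • v) - f z - (f (z + c • v) - f z - c * fderiv ℝ f z v) := by ring
    rw [e]
    exact (norm_sub_le _ _).trans (by rw [← e]; gcongr; exact norm_sub_le _ _)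
  rw [norm_mul, Real.norm_of_nonneg hcp.le] at h3
  have h4 : c * ‖fderiv ℝ f z v‖ ≤ c * ((C * 2 ^ (2 * k) + C + K) * ‖z‖ ^ k * ‖v‖) := by
    have e : c * ((C * 2 ^ (2 * k) + C + K) * ‖z‖ ^ k * ‖v‖)
        = (C * 2 ^ (2 * k) + C + K) * (‖z‖ ^ k) ^ 2 := by
      rw [hc]
      field_simp
    rw [e]
    linarith
  exact le_of_mul_le_mul_left h4 hcp

/-- The derivative of a smooth function of order `m + 1` at the origin has order `m`. -/
theorem fderiv_isBigO {ι : Type*} [Fintype ι] [DecidableEq ι] {f : EuclideanSpace ℝ ι → ℝ} {m : ℕ}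
    (hf : ContDiffAt ℝ (⊤ : ℕ∞) f 0) (hO : f =O[𝓝 0] fun z => ‖z‖ ^ (m + 1)) :
    fderiv ℝ f =O[𝓝 0] fun z => ‖z‖ ^ m := by
  -- `fderiv_isBigO_half` loses half of the order, so the Taylor polynomial is removed up to degree
  -- 2m + 1. The rest has order 2(m + 1), for which half is enough, and the polynomial part is
  -- differentiated directly.
  obtain ⟨T, hT, -, hTO⟩ := exists_leading_part hf hO (2 * (m + 1)) (by omega)
  set S : EuclideanSpace ℝ ι → ℝ := fun z => ∑ j ∈ Finset.Ico (m + 1) (2 * (m + 1)), T j z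
  have hS : ContDiff ℝ (⊤ : ℕ∞) S :=
    ContDiff.sum fun j _ => contDiff_of_mem_powerSpan (hT j)
  have h1 : fderiv ℝ (fun z => f z - S z) =O[𝓝 0] fun z => ‖z‖ ^ m :=
    (fderiv_isBigO_half (by omega) ((hf.sub hS.contDiffAt).of_le (WithTop.coe_le_coe.2 (le_top : (2 : ℕ∞) ≤ ⊤)))
      hTO).trans (isBigO_norm_pow_of_le m.le_succ)
  have h2 : fderiv ℝ S =O[𝓝 0] fun z => ‖z‖ ^ m := by
    have : fderiv ℝ S = fun z => ∑ j ∈ Finset.Ico (m + 1) (2 * (m + 1)), fderiv ℝ (T j) z := by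
      funext z
      exact fderiv_fun_sum fun j _ =>
        (contDiff_of_mem_powerSpan (hT j) (k := 1)).differentiable one_ne_zero z
    rw [this]
    refine IsBigO.fun_sum fun j hj => ?_
    obtain ⟨i, rfl⟩ : ∃ i, j = i + 1 := ⟨j - 1, by have := (Finset.mem_Ico.1 hj).1; omega⟩
    exact (fderiv_isBigO_of_mem_powerSpan (hT _) _).trans
      (isBigO_norm_pow_of_le (by have := (Finset.mem_Ico.1 hj).1; omega))
  have hdiff : ∀ᶠ z in 𝓝 (0 : EuclideanSpace ℝ ι), DifferentiableAt ℝ f z :=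
    ((hf.of_le (m := 1) (by simp)).eventually (by simp)).mono
      fun z hz => hz.differentiableAt one_ne_zero
  refine (h1.add h2).congr' ?_ EventuallyEq.rfl
  filter_upwards [hdiff] with z hz
  rw [fderiv_fun_sub hz (hS.differentiable (by simp) z), sub_add_cancel]

end Derivative

/-! ### The homological equation. -/

section Homological

variable {n : ℕ}

/-- The Hamiltonian vector field of the harmonic oscillator, in coordinates. -/
def harmonicField (ω : Fin n → ℝ) (z : Phase n) : Phase n :=
  WithLp.toLp 2 (Sum.elim (fun j => ω j * z (Sum.inr j)) (fun j => -(ω j * z (Sum.inl j))))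

/-- The complex coordinates `q_j + i p_j` and `q_j - i p_j`. -/
def complexCoord (z : Phase n) : Fin n ⊕ Fin n → ℂ :=
  Sum.elim (fun j => z (Sum.inl j) + Complex.I * z (Sum.inr j))
    (fun j => z (Sum.inl j) - Complex.I * z (Sum.inr j))

/-- The eigenvalues of the harmonic flow on the complex coordinates. -/
def harmonicEigenvalue (ω : Fin n → ℝ) : Fin n ⊕ Fin n → ℂ :=
  Sum.elim (fun j => -(Complex.I * ω j)) (fun j => Complex.I * ω j)

/-- The harmonic field is linear and diagonal in these coordinates, so derivatives along it can be
computed on straight segments, without its flow. -/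
theorem complexCoord_add_smul (ω : Fin n → ℝ) (z : Phase n) (t : ℝ) (s : Fin n ⊕ Fin n) :
    complexCoord (z + t • harmonicField ω z) s
      = (1 + t * harmonicEigenvalue ω s) * complexCoord z s := by
  rcases s with j | j <;>
  · simp [complexCoord, harmonicField, harmonicEigenvalue]
    ring_nf
    simp only [Complex.I_sq]
    ring

/-- A real linear combination of powers of linear forms is a homogeneous polynomial in the complex
coordinates. -/
theorem exists_complex_polynomial {m : ℕ} {f : Phase n → ℝ} (hf : f ∈ powerSpan (Phase n) m) :
    ∃ p : MvPolynomial (Fin n ⊕ Fin n) ℂ, p.IsHomogeneous m ∧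
      ∀ z, (f z : ℂ) = MvPolynomial.eval (complexCoord z) p := by
  induction hf using Submodule.span_induction with
  | mem f hf =>
    obtain ⟨ℓ, rfl⟩ := hf
    -- Inverse change of coordinates: q is half the sum and p is the difference divided by 2i.
    let p : MvPolynomial (Fin n ⊕ Fin n) ℂ := ∑ j,
      (MvPolynomial.C (ℓ (EuclideanSpace.single (Sum.inl j) 1) / 2 : ℂ)
          * (MvPolynomial.X (Sum.inl j) + MvPolynomial.X (Sum.inr j))
        + MvPolynomial.C (ℓ (EuclideanSpace.single (Sum.inr j) 1) / (2 * Complex.I) : ℂ)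
          * (MvPolynomial.X (Sum.inl j) - MvPolynomial.X (Sum.inr j)))
    have hp : p.IsHomogeneous 1 := by
      refine MvPolynomial.IsHomogeneous.sum _ _ _ fun j _ => ?_
      have hl := MvPolynomial.isHomogeneous_X ℂ (Sum.inl j : Fin n ⊕ Fin n)
      have hr := MvPolynomial.isHomogeneous_X ℂ (Sum.inr j : Fin n ⊕ Fin n)
      exact ((hl.add hr).C_mul _).add ((hl.sub hr).C_mul _)
    refine ⟨p ^ m, by simpa using hp.pow m, fun z => ?_⟩
    have h : ℓ z = ∑ s, z s * ℓ (EuclideanSpace.single s 1) := by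
      have h := congrArg ℓ ((EuclideanSpace.basisFun (Fin n ⊕ Fin n) ℝ).sum_repr z)
      rw [map_sum] at h
      simpa using h.symm
    rw [map_pow, Complex.ofReal_pow, h, Fintype.sum_sum_type, ← Finset.sum_add_distrib]
    congr 1
    simp only [p, map_sum, map_add, map_mul, map_sub, MvPolynomial.eval_C, MvPolynomial.eval_X]
    push_cast
    refine Finset.sum_congr rfl fun j _ => ?_
    simp only [complexCoord, Sum.elim_inl, Sum.elim_inr]
    field_simp
    ring
  | zero => exact ⟨0, MvPolynomial.isHomogeneous_zero _ _ _, by simp⟩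
  | add f g _ _ hf hg =>
    obtain ⟨p, hp, hpe⟩ := hf
    obtain ⟨q, hq, hqe⟩ := hg
    exact ⟨p + q, hp.add hq, fun z => by simp [hpe, hqe]⟩
  | smul a f _ hf =>
    obtain ⟨p, hp, hpe⟩ := hf
    exact ⟨MvPolynomial.C (a : ℂ) * p, hp.C_mul _, fun z => by simp [hpe]⟩

/-- A monomial in the complex coordinates. -/
def complexMonomial (d : Fin n ⊕ Fin n → ℕ) (z : Phase n) : ℂ :=
  ∏ s, complexCoord z s ^ d s

theorem complexCoord_re_im_mem (s : Fin n ⊕ Fin n) :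
    (fun z : Phase n => (complexCoord z s).re) ∈ powerSpan (Phase n) 1 ∧
      (fun z : Phase n => (complexCoord z s).im) ∈ powerSpan (Phase n) 1 := by
  have h : ∀ s, (fun z : Phase n => z s) ∈ powerSpan (Phase n) 1 := fun s => by
    simpa using pow_mem_powerSpan (EuclideanSpace.proj s : Phase n →L[ℝ] ℝ) 1
  rcases s with j | j
  · constructor
    · simpa [complexCoord] using h (Sum.inl j)
    · simpa [complexCoord] using h (Sum.inr j)
  · constructor
    · simpa [complexCoord] using h (Sum.inl j)
    · convert (powerSpan (Phase n) 1).neg_mem (h (Sum.inr j)) using 1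
      funext z
      simp [complexCoord]

theorem re_im_mul_mem {m k : ℕ} {f g : Phase n → ℂ}
    (hf : (fun z => (f z).re) ∈ powerSpan (Phase n) m ∧
      (fun z => (f z).im) ∈ powerSpan (Phase n) m)
    (hg : (fun z => (g z).re) ∈ powerSpan (Phase n) k ∧
      (fun z => (g z).im) ∈ powerSpan (Phase n) k) :
    (fun z => (f z * g z).re) ∈ powerSpan (Phase n) (m + k) ∧
      (fun z => (f z * g z).im) ∈ powerSpan (Phase n) (m + k) := by
  simp only [Complex.mul_re, Complex.mul_im]
  exact ⟨sub_mem (mul_mem_powerSpan hf.1 hg.1) (mul_mem_powerSpan hf.2 hg.2),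
    add_mem (mul_mem_powerSpan hf.1 hg.2) (mul_mem_powerSpan hf.2 hg.1)⟩

theorem re_im_const_mem (c : ℂ) :
    (fun _ : Phase n => c.re) ∈ powerSpan (Phase n) 0 ∧
      (fun _ : Phase n => c.im) ∈ powerSpan (Phase n) 0 :=
  ⟨const_mem_powerSpan _, const_mem_powerSpan _⟩

/-- This brings complex solutions back to real homogeneous polynomials. Both parts are tracked
together because a complex product mixes them. -/
theorem complexMonomial_re_im_mem (d : Fin n ⊕ Fin n → ℕ) (c : ℂ) :
    (fun z : Phase n => (c * complexMonomial d z).re) ∈ powerSpan (Phase n) (∑ s, d s) ∧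
      (fun z : Phase n => (c * complexMonomial d z).im) ∈ powerSpan (Phase n) (∑ s, d s) := by
  have hpow : ∀ (s : Fin n ⊕ Fin n) (k : ℕ),
      (fun z : Phase n => (complexCoord z s ^ k).re) ∈ powerSpan (Phase n) k ∧
        (fun z : Phase n => (complexCoord z s ^ k).im) ∈ powerSpan (Phase n) k := by
    intro s k
    induction k with
    | zero => simpa using re_im_const_mem (n := n) 1
    | succ k ih =>
      simp only [pow_succ]
      exact re_im_mul_mem ih (complexCoord_re_im_mem s)
  have hprod : ∀ S : Finset (Fin n ⊕ Fin n),
      (fun z : Phase n => (∏ s ∈ S, complexCoord z s ^ d s).re)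
          ∈ powerSpan (Phase n) (∑ s ∈ S, d s) ∧
        (fun z : Phase n => (∏ s ∈ S, complexCoord z s ^ d s).im)
          ∈ powerSpan (Phase n) (∑ s ∈ S, d s) := by
    intro S
    induction S using Finset.induction_on with
    | empty => simpa using re_im_const_mem (n := n) 1
    | insert s S hs ih =>
      simp only [Finset.prod_insert hs, Finset.sum_insert hs]
      exact re_im_mul_mem (hpow s (d s)) ih
  have h := re_im_mul_mem (re_im_const_mem c) (hprod Finset.univ)
  rwa [zero_add] at h

theorem hasDerivAt_complexMonomial (ω : Fin n → ℝ) (d : Fin n ⊕ Fin n → ℕ) (z : Phase n) :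
    HasDerivAt (fun t : ℝ => complexMonomial d (z + t • harmonicField ω z))
      ((∑ s, d s * harmonicEigenvalue ω s) * complexMonomial d z) 0 := by
  have h1 : (fun t : ℝ => complexMonomial d (z + t • harmonicField ω z))
      = fun t : ℝ => (∏ s, (1 + (t : ℂ) * harmonicEigenvalue ω s) ^ d s)
        * complexMonomial d z := by
    funext t
    simp only [complexMonomial, complexCoord_add_smul, mul_pow, Finset.prod_mul_distrib]
  rw [h1]
  refine HasDerivAt.mul_const ?_ _
  have h2 : ∀ s, HasDerivAt (fun t : ℝ => (1 + (t : ℂ) * harmonicEigenvalue ω s) ^ d s)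
      (d s * harmonicEigenvalue ω s) 0 := by
    intro s
    have h3 : HasDerivAt (fun t : ℝ => 1 + (t : ℂ) * harmonicEigenvalue ω s)
        (harmonicEigenvalue ω s) 0 := by
      simpa using ((Complex.ofRealCLM.hasDerivAt (x := (0 : ℝ))).mul_const
        (harmonicEigenvalue ω s)).const_add 1
    simpa using h3.fun_pow (d s)
  simpa using HasDerivAt.fun_finsetProd (u := Finset.univ) fun s _ => h2 s

/-- The differences of the exponents form the integer vector to which non-resonance is applied. -/
theorem sum_mul_harmonicEigenvalue (ω : Fin n → ℝ) (d : Fin n ⊕ Fin n → ℕ) :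
    ∑ s, d s * harmonicEigenvalue ω s
      = -Complex.I * ((∑ j, (((d (Sum.inl j) : ℤ) - d (Sum.inr j) : ℤ) : ℝ) * ω j : ℝ) : ℂ) := by
  rw [Fintype.sum_sum_type, ← Finset.sum_add_distrib, Complex.ofReal_sum, Finset.mul_sum]
  refine Finset.sum_congr rfl fun j _ => ?_
  simp only [harmonicEigenvalue, Sum.elim_inl, Sum.elim_inr]
  push_cast
  ring

/-- `f - {G, H₀}` is a polynomial in the actions, all terms being homogeneous of degree `m`. -/
def HasHomologicalSolution (ω : Fin n → ℝ) (m : ℕ) (f : Phase n → ℝ) : Prop :=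
  ∃ G ∈ powerSpan (Phase n) m, ∃ Z : MvPolynomial (Fin n) ℝ, 2 * Z.totalDegree ≤ m ∧
    (fun z => MvPolynomial.eval (fun j => action j z) Z) ∈ powerSpan (Phase n) m ∧
    ∀ z, f z - fderiv ℝ G z (harmonicField ω z) = MvPolynomial.eval (fun j => action j z) Z

theorem HasHomologicalSolution.zero (ω : Fin n → ℝ) (m : ℕ) :
    HasHomologicalSolution ω m (fun _ => 0) := by
  refine ⟨0, Submodule.zero_mem _, 0, by simp, ?_, fun z => ?_⟩
  · simp only [map_zero]
    exact Submodule.zero_mem _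
  · simp

theorem HasHomologicalSolution.add {ω : Fin n → ℝ} {m : ℕ} {f g : Phase n → ℝ}
    (hf : HasHomologicalSolution ω m f) (hg : HasHomologicalSolution ω m g) :
    HasHomologicalSolution ω m (fun z => f z + g z) := by
  obtain ⟨G, hG, Z, hZ, hZm, h⟩ := hf
  obtain ⟨G', hG', Z', hZ', hZm', h'⟩ := hg
  refine ⟨G + G', add_mem hG hG', Z + Z', ?_, ?_, fun z => ?_⟩
  · have := MvPolynomial.totalDegree_add Z Z'
    rcases le_max_iff.1 this with h | h <;> omega
  · simp only [map_add]
    exact add_mem hZm hZm'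
  · rw [fderiv_add ((contDiff_of_mem_powerSpan hG (k := 1)).differentiable one_ne_zero z)
      ((contDiff_of_mem_powerSpan hG' (k := 1)).differentiable one_ne_zero z), map_add, ← h, ← h']
    simp only [add_apply]
    ring

/-- If conjugate exponents agree, the monomial is a product of powers of 2 I_j and goes into Z.
Otherwise its eigenvalue is nonzero and can be divided out; taking real parts is compatible with
differentiating along a real field. -/
theorem hasHomologicalSolution_monomial {ω : Fin n → ℝ} (hω : NonResonant ω)
    (d : Fin n ⊕ Fin n → ℕ) (c : ℂ) :
    HasHomologicalSolution ω (∑ s, d s) (fun z => (c * complexMonomial d z).re) := by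
  by_cases hd : ∀ j, d (Sum.inl j) = d (Sum.inr j)
  · let e : Fin n →₀ ℕ := Finsupp.equivFunOnFinite.symm fun j => d (Sum.inl j)
    let Z : MvPolynomial (Fin n) ℝ := MvPolynomial.monomial e (c.re * ∏ j, 2 ^ d (Sum.inl j))
    have hsum : ∑ s, d s = 2 * ∑ j, d (Sum.inl j) := by
      rw [Fintype.sum_sum_type, two_mul]
      congr 1
      exact Finset.sum_congr rfl fun j _ => (hd j).symm
    have hZ : ∀ z, (c * complexMonomial d z).re = MvPolynomial.eval (fun j => action j z) Z := by
      intro z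
      have h1 : complexMonomial d z = ((∏ j, (2 * action j z) ^ d (Sum.inl j) : ℝ) : ℂ) := by
        rw [complexMonomial, Fintype.prod_sum_type, ← Finset.prod_mul_distrib, Complex.ofReal_prod]
        refine Finset.prod_congr rfl fun j _ => ?_
        rw [← hd j, ← mul_pow, Complex.ofReal_pow]
        congr 1
        simp only [complexCoord, action, Sum.elim_inl, Sum.elim_inr]
        push_cast
        ring_nf
        simp only [Complex.I_sq]
        ring
      rw [h1, Complex.re_mul_ofReal, MvPolynomial.eval_monomial, Finsupp.prod_fintype _ _ (by simp)]
      simp only [mul_pow, Finset.prod_mul_distrib]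
      simp [e]
      ring
    refine ⟨0, Submodule.zero_mem _, Z, ?_, ?_, fun z => ?_⟩
    · rw [hsum]
      refine Nat.mul_le_mul_left 2 ((MvPolynomial.totalDegree_monomial_le _ _).trans ?_)
      rw [Finsupp.sum_fintype _ _ (by simp)]
      simp [e]
    · simp only [← hZ]
      exact (complexMonomial_re_im_mem d c).1
    · simp [hZ]
  · set μ : ℂ := ∑ s, d s * harmonicEigenvalue ω s with hμ
    have hμ0 : μ ≠ 0 := by
      rw [hμ, sum_mul_harmonicEigenvalue]
      refine mul_ne_zero (neg_ne_zero.2 Complex.I_ne_zero) ?_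
      rw [Complex.ofReal_ne_zero]
      refine hω (fun j => (d (Sum.inl j) : ℤ) - d (Sum.inr j)) fun h => hd fun j => ?_
      have := congrFun h j
      simp only [Pi.zero_apply] at this
      omega
    have hG := (complexMonomial_re_im_mem d (c / μ)).1
    refine ⟨_, hG, 0, by simp, ?_, fun z => ?_⟩
    · simp only [map_zero]
      exact Submodule.zero_mem _
    · have h1 : HasDerivAt (fun t : ℝ => (c / μ * complexMonomial d
          (z + t • harmonicField ω z)).re) (c * complexMonomial d z).re 0 := by
        have h := Complex.reCLM.hasFDerivAt.comp_hasDerivAt (0 : ℝ)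
          ((hasDerivAt_complexMonomial ω d z).const_mul (c / μ))
        have e : c / μ * (μ * complexMonomial d z) = c * complexMonomial d z := by
          field_simp
        rw [← hμ, e] at h
        exact h
      have h2 : HasDerivAt (fun t : ℝ => z + t • harmonicField ω z) (harmonicField ω z) 0 := by
        simpa using ((hasDerivAt_id (0 : ℝ)).smul_const (harmonicField ω z)).const_add z
      have h3 : HasFDerivAt (fun z : Phase n => (c / μ * complexMonomial d z).re)
          (fderiv ℝ (fun z : Phase n => (c / μ * complexMonomial d z).re) z)
          (z + (0 : ℝ) • harmonicField ω z) := by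
        rw [zero_smul, add_zero]
        exact ((contDiff_of_mem_powerSpan hG (k := 1)).differentiable one_ne_zero z).hasFDerivAt
      have h4 := h3.comp_hasDerivAt (0 : ℝ) h2
      rw [h4.unique h1, sub_self, map_zero]

/-- The homological equation is solvable for a non-resonant frequency vector. -/
theorem hasHomologicalSolution {ω : Fin n → ℝ} (hω : NonResonant ω) {m : ℕ} {f : Phase n → ℝ}
    (hf : f ∈ powerSpan (Phase n) m) : HasHomologicalSolution ω m f := by
  obtain ⟨p, hp, hpe⟩ := exists_complex_polynomial hf
  have h1 : f = fun z => ∑ d ∈ p.support, (p.coeff d * complexMonomial d z).re := by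
    funext z
    rw [← Complex.ofReal_re (f z), hpe, MvPolynomial.eval_eq', Complex.re_sum]
    rfl
  have h2 : ∀ S ⊆ p.support,
      HasHomologicalSolution ω m fun z => ∑ d ∈ S, (p.coeff d * complexMonomial d z).re := by
    intro S
    induction S using Finset.induction_on with
    | empty => intro _; simpa using HasHomologicalSolution.zero ω m
    | insert d S hd ih =>
      intro hS
      simp only [Finset.sum_insert hd]
      refine HasHomologicalSolution.add ?_ (ih ((Finset.subset_insert _ _).trans hS))
      have hdm := hp (MvPolynomial.mem_support_iff.1 (hS (Finset.mem_insert_self d S)))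
      have hdm' : ∑ s, d s = m := by
        rw [← hdm, Finsupp.weight_apply, Finsupp.sum_fintype _ _ (by simp)]
        simp
      rw [← hdm']
      exact hasHomologicalSolution_monomial hω d _
  rw [h1]
  exact h2 _ subset_rfl

end Homological

/-! ### Symplectic shears and the normal form. -/

section Canonical

variable {n : ℕ}

/-- The Poisson form on covectors. -/
noncomputable def poissonForm (α β : Phase n →L[ℝ] ℝ) : ℝ :=
  ∑ j, (α (EuclideanSpace.single (Sum.inl j) 1) * β (EuclideanSpace.single (Sum.inr j) 1)
    - α (EuclideanSpace.single (Sum.inr j) 1) * β (EuclideanSpace.single (Sum.inl j) 1))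

theorem poissonBracket_eq_poissonForm (F G : Phase n → ℝ) (z : Phase n) :
    poissonBracket F G z = poissonForm (fderiv ℝ F z) (fderiv ℝ G z) :=
  rfl

/-- The Hamiltonian vector of a linear form. -/
noncomputable def hamVector (ℓ : Phase n →L[ℝ] ℝ) : Phase n :=
  WithLp.toLp 2 (Sum.elim (fun j => ℓ (EuclideanSpace.single (Sum.inr j) 1))
    (fun j => -ℓ (EuclideanSpace.single (Sum.inl j) 1)))

theorem hamVectorField_eq_hamVector (H : Phase n → ℝ) (z : Phase n) :
    hamVectorField H z = hamVector (fderiv ℝ H z) :=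
  rfl

theorem apply_eq_sum_coord (α : Phase n →L[ℝ] ℝ) (z : Phase n) :
    α z = ∑ j, (z (Sum.inl j) * α (EuclideanSpace.single (Sum.inl j) 1)
      + z (Sum.inr j) * α (EuclideanSpace.single (Sum.inr j) 1)) := by
  have h := congrArg α ((EuclideanSpace.basisFun (Fin n ⊕ Fin n) ℝ).sum_repr z)
  rw [map_sum] at h
  rw [← h, Fintype.sum_sum_type, ← Finset.sum_add_distrib]
  simp

theorem apply_hamVector (α ℓ : Phase n →L[ℝ] ℝ) : α (hamVector ℓ) = poissonForm α ℓ := by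
  rw [apply_eq_sum_coord, poissonForm]
  refine Finset.sum_congr rfl fun j _ => ?_
  simp only [hamVector, Sum.elim_inl, Sum.elim_inr]
  ring

theorem poissonForm_self (ℓ : Phase n →L[ℝ] ℝ) : poissonForm ℓ ℓ = 0 :=
  Finset.sum_eq_zero fun j _ => by ring

theorem poissonForm_swap (α β : Phase n →L[ℝ] ℝ) : poissonForm α β = -poissonForm β α := by
  rw [poissonForm, poissonForm, ← Finset.sum_neg_distrib]
  exact Finset.sum_congr rfl fun j _ => by ring

theorem poissonForm_add_smul (α β ℓ : Phase n →L[ℝ] ℝ) (a b : ℝ) :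
    poissonForm (α + a • ℓ) (β + b • ℓ)
      = poissonForm α β + b * poissonForm α ℓ + a * poissonForm ℓ β := by
  simp only [poissonForm, Finset.mul_sum, ← Finset.sum_add_distrib]
  refine Finset.sum_congr rfl fun j _ => ?_
  simp only [add_apply, smul_apply, smul_eq_mul]
  ring

/-- A linear map whose transpose preserves the Poisson form. -/
def IsPoissonMap (A : Phase n →L[ℝ] Phase n) : Prop :=
  ∀ α β : Phase n →L[ℝ] ℝ, poissonForm (α.comp A) (β.comp A) = poissonForm α β

theorem IsPoissonMap.comp {A B : Phase n →L[ℝ] Phase n} (hA : IsPoissonMap A)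
    (hB : IsPoissonMap B) : IsPoissonMap (A.comp B) := fun α β => by
  rw [← ContinuousLinearMap.comp_assoc, ← ContinuousLinearMap.comp_assoc, hB, hA]

/-- The transpose adds to each covector a multiple of ℓ proportional to its bracket with ℓ; the two
cross terms cancel by antisymmetry. -/
theorem isPoissonMap_transvection (ℓ : Phase n →L[ℝ] ℝ) (a : ℝ) :
    IsPoissonMap (ContinuousLinearMap.id ℝ (Phase n) + (a • ℓ).smulRight (hamVector ℓ)) := by
  intro α β
  have h : ∀ α : Phase n →L[ℝ] ℝ,
      α.comp (ContinuousLinearMap.id ℝ (Phase n) + (a • ℓ).smulRight (hamVector ℓ))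
        = α + (a * poissonForm α ℓ) • ℓ := by
    intro α
    ext v
    simp [apply_hamVector]
    ring
  rw [h, h, poissonForm_add_smul, poissonForm_swap ℓ β]
  ring

/-- An analytic symplectic diffeomorphism of the whole phase space, tangent to the identity at the
origin. -/
structure IsGlobalCanonical (e : Phase n ≃ₜ Phase n) : Prop where
  analytic : AnalyticOnNhd ℝ e Set.univ
  analytic_symm : AnalyticOnNhd ℝ e.symm Set.univ
  poisson : ∀ z, IsPoissonMap (fderiv ℝ e z)
  near_id : (fun z => e z - z) =O[𝓝 0] fun z => ‖z‖ ^ 2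

theorem IsGlobalCanonical.refl : IsGlobalCanonical (Homeomorph.refl (Phase n)) where
  analytic := analyticOnNhd_id
  analytic_symm := analyticOnNhd_id
  poisson z α β := by
    have : fderiv ℝ (Homeomorph.refl (Phase n)) z = ContinuousLinearMap.id ℝ (Phase n) :=
      fderiv_id
    rw [this, ContinuousLinearMap.comp_id, ContinuousLinearMap.comp_id]
  near_id := by simpa using isBigO_zero _ _

theorem IsGlobalCanonical.map_zero {e : Phase n ≃ₜ Phase n} (he : IsGlobalCanonical e) :
    e 0 = 0 := by
  have h : (fun z => e z - z) =O[𝓝 0] fun z : Phase n => ‖z - 0‖ ^ 2 := by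
    simpa using he.near_id
  simpa using h.eq_zero_of_norm_pow two_ne_zero

theorem IsGlobalCanonical.contDiff {e : Phase n ≃ₜ Phase n} (he : IsGlobalCanonical e)
    {k : WithTop ℕ∞} : ContDiff ℝ k e :=
  contDiffOn_univ.1 (he.analytic.contDiffOn uniqueDiffOn_univ)

theorem IsGlobalCanonical.contDiff_symm {e : Phase n ≃ₜ Phase n} (he : IsGlobalCanonical e)
    {k : WithTop ℕ∞} : ContDiff ℝ k e.symm :=
  contDiffOn_univ.1 (he.analytic_symm.contDiffOn uniqueDiffOn_univ)

theorem isBigO_norm_of_near_id {E : Type*} [NormedAddCommGroup E] {φ : E → E} {k : ℕ} (hk : 1 ≤ k)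
    (h : (fun z => φ z - z) =O[𝓝 0] fun z => ‖z‖ ^ k) : φ =O[𝓝 0] fun z => ‖z‖ := by
  have h1 := h.trans (isBigO_norm_pow_of_le hk)
  simp only [pow_one] at h1
  exact (h1.add (isBigO_refl (fun z : E => z) (𝓝 0)).norm_right).congr_left fun z => by simp

theorem IsGlobalCanonical.trans {e₁ e₂ : Phase n ≃ₜ Phase n} (h₁ : IsGlobalCanonical e₁)
    (h₂ : IsGlobalCanonical e₂) : IsGlobalCanonical (e₁.trans e₂) where
  analytic := h₂.analytic.comp h₁.analytic (Set.mapsTo_univ _ _)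
  analytic_symm := h₁.analytic_symm.comp h₂.analytic_symm (Set.mapsTo_univ _ _)
  poisson z := by
    have : fderiv ℝ (e₁.trans e₂) z = (fderiv ℝ e₂ (e₁ z)).comp (fderiv ℝ e₁ z) :=
      fderiv_comp z (h₂.contDiff.differentiable one_ne_zero _)
        (h₁.contDiff.differentiable one_ne_zero _)
    rw [this]
    exact (h₂.poisson _).comp (h₁.poisson _)
  near_id := by
    have ht : Tendsto e₁ (𝓝 0) (𝓝 0) := by
      simpa [h₁.map_zero] using e₁.continuous.tendsto 0
    have h := (h₂.near_id.comp_tendsto ht).trans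
      ((isBigO_norm_of_near_id one_le_two h₁.near_id).norm_left.pow 2)
    exact (h.add h₁.near_id).congr_left fun z => by simp

/-- The time-`c` map of the Hamiltonian `ℓ ^ (k + 1) / (k + 1)`. -/
noncomputable def shear (ℓ : Phase n →L[ℝ] ℝ) (c : ℝ) (k : ℕ) (z : Phase n) : Phase n :=
  z + (c * ℓ z ^ k) • hamVector ℓ

/-- ℓ is constant along its own Hamiltonian direction. This makes the shear a flow map, inverted by
changing the sign of c. -/
theorem apply_shear (ℓ : Phase n →L[ℝ] ℝ) (c : ℝ) (k : ℕ) (z : Phase n) :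
    ℓ (shear ℓ c k z) = ℓ z := by
  simp [shear, apply_hamVector, poissonForm_self]

theorem shear_neg_shear (ℓ : Phase n →L[ℝ] ℝ) (c : ℝ) (k : ℕ) (z : Phase n) :
    shear ℓ (-c) k (shear ℓ c k z) = z := by
  rw [shear, apply_shear, shear]
  module

theorem analyticOnNhd_shear (ℓ : Phase n →L[ℝ] ℝ) (c : ℝ) (k : ℕ) :
    AnalyticOnNhd ℝ (shear ℓ c k) Set.univ := fun z _ =>
  analyticAt_id.add ((analyticAt_const.mul ((ℓ.analyticAt z).pow k)).smul analyticAt_const)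

/-- Shears as homeomorphisms of the phase space. -/
noncomputable def shearHomeomorph (ℓ : Phase n →L[ℝ] ℝ) (c : ℝ) (k : ℕ) : Phase n ≃ₜ Phase n where
  toFun := shear ℓ c k
  invFun := shear ℓ (-c) k
  left_inv := shear_neg_shear ℓ c k
  right_inv z := by simpa using shear_neg_shear ℓ (-c) k z
  continuous_toFun := continuousOn_univ.1 (analyticOnNhd_shear ℓ c k).continuousOn
  continuous_invFun := continuousOn_univ.1 (analyticOnNhd_shear ℓ (-c) k).continuousOn

theorem shear_sub_isBigO (ℓ : Phase n →L[ℝ] ℝ) (c : ℝ) (k : ℕ) :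
    (fun z => shear ℓ c k z - z) =O[𝓝 0] fun z => ‖z‖ ^ k := by
  have h1 : (fun z => c * ℓ z ^ k) =O[𝓝 0] fun z => ‖z‖ ^ k :=
    (((ℓ.isBigO_id _).norm_right).pow k).const_mul_left c
  have h2 : (fun _ : Phase n => hamVector ℓ) =O[𝓝 0] fun _ => (1 : ℝ) :=
    isBigO_const_const _ one_ne_zero _
  simpa [shear] using h1.smul h2

theorem isGlobalCanonical_shear (ℓ : Phase n →L[ℝ] ℝ) (c : ℝ) {k : ℕ} (hk : 2 ≤ k) :
    IsGlobalCanonical (shearHomeomorph ℓ c k) where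
  analytic := analyticOnNhd_shear ℓ c k
  analytic_symm := analyticOnNhd_shear ℓ (-c) k
  poisson z := by
    have h : HasFDerivAt (shear ℓ c k) (ContinuousLinearMap.id ℝ (Phase n)
        + ((c * (k * ℓ z ^ (k - 1))) • ℓ).smulRight (hamVector ℓ)) z := by
      have h1 := (((HasFDerivAt.pow (ℓ.hasFDerivAt (x := z)) k).const_mul c).smul_const (hamVector ℓ))
      refine ((hasFDerivAt_id z).add h1).congr_fderiv ?_
      ext v
      simp
      exact Or.inl (by ring)
    have h' : fderiv ℝ (shearHomeomorph ℓ c k) z = _ := h.fderiv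
    rw [h']
    exact isPoissonMap_transvection _ _
  near_id := (shear_sub_isBigO ℓ c k).trans (isBigO_norm_pow_of_le hk)

/-- H₀ is quadratic, so the expansion stops at second order; its linear term is what the homological
equation cancels. -/
theorem harmonic_add_smul_hamVector (ω : Fin n → ℝ) (ℓ : Phase n →L[ℝ] ℝ) (a : ℝ) (z : Phase n) :
    harmonic ω (z + a • hamVector ℓ)
      = harmonic ω z - a * ℓ (harmonicField ω z) + a ^ 2 * harmonic ω (hamVector ℓ) := by
  rw [apply_eq_sum_coord]
  simp only [harmonic, Finset.mul_sum, ← Finset.sum_add_distrib, ← Finset.sum_sub_distrib]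
  refine Finset.sum_congr rfl fun j _ => ?_
  simp [action, hamVector, harmonicField]
  ring

/-- Composing a function of order three with a near-identity map. -/
theorem comp_sub_isBigO {Q : Phase n → ℝ} (hQ : ContDiffAt ℝ (⊤ : ℕ∞) Q 0)
    (hO : Q =O[𝓝 0] fun z => ‖z‖ ^ 3) {φ : Phase n → Phase n} {k : ℕ} (hk : 1 ≤ k)
    (hφ : (fun z => φ z - z) =O[𝓝 0] fun z => ‖z‖ ^ k) :
    (fun z => Q (φ z) - Q z) =O[𝓝 0] fun z => ‖z‖ ^ (k + 2) := by
  obtain ⟨C, hC0, hC⟩ := (fderiv_isBigO hQ hO).exists_pos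
  rw [IsBigOWith] at hC
  have hdiff : ∀ᶠ z in 𝓝 (0 : Phase n), DifferentiableAt ℝ Q z :=
    ((hQ.of_le (m := 1) (by simp)).eventually (by simp)).mono
      fun z hz => hz.differentiableAt one_ne_zero
  obtain ⟨δ, hδ, hball⟩ := Metric.eventually_nhds_iff_ball.1 (hC.and hdiff)
  obtain ⟨B, hB0, hB⟩ := (isBigO_norm_of_near_id hk hφ).exists_pos
  rw [IsBigOWith] at hB
  -- Mean value inequality on the ball of radius (B + 1)‖z‖, which contains both z and φ z and on
  -- which dQ is O(‖z‖²).
  have hmain : (fun z => Q (φ z) - Q z) =O[𝓝 0] fun z => ‖z‖ ^ 2 * ‖φ z - z‖ := by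
    refine IsBigO.of_bound (C * (B + 1) ^ 2) ?_
    filter_upwards [hB, Metric.ball_mem_nhds 0 (show 0 < δ / (B + 1) by positivity)] with z hBz hz
    rw [norm_norm] at hBz
    rw [mem_ball_zero_iff, lt_div_iff₀ (by positivity)] at hz
    have hin : ∀ x ∈ Metric.closedBall (0 : Phase n) ((B + 1) * ‖z‖), x ∈ Metric.ball 0 δ := by
      intro x hx
      rw [mem_closedBall_zero_iff] at hx
      rw [mem_ball_zero_iff]
      linarith
    have h := Convex.norm_image_sub_le_of_norm_hasFDerivWithin_le (𝕜 := ℝ) (f := Q)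
      (f' := fderiv ℝ Q) (s := Metric.closedBall 0 ((B + 1) * ‖z‖)) (x := z) (y := φ z)
      (C := C * ((B + 1) * ‖z‖) ^ 2)
      (fun x hx => (hball x (hin x hx)).2.hasFDerivAt.hasFDerivWithinAt)
      (fun x hx => ?_) (convex_closedBall _ _) ?_ ?_
    · refine h.trans_eq ?_
      rw [norm_mul, norm_norm, norm_pow, norm_norm]
      ring
    · refine (hball x (hin x hx)).1.trans ?_
      rw [norm_pow, norm_norm]
      gcongr
      exact mem_closedBall_zero_iff.1 hx
    · rw [mem_closedBall_zero_iff]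
      nlinarith [norm_nonneg z]
    · rw [mem_closedBall_zero_iff]
      nlinarith [norm_nonneg z]
  refine (hmain.trans ((isBigO_refl _ _).mul hφ.norm_left)).congr_right fun z => ?_
  ring

theorem harmonicField_isBigO (ω : Fin n → ℝ) : harmonicField ω =O[𝓝 0] fun z => ‖z‖ := by
  let L : Phase n →ₗ[ℝ] Phase n :=
    { toFun := harmonicField ω
      map_add' := fun x y => by ext (j | j) <;> simp [harmonicField] <;> ring
      map_smul' := fun a x => by ext (j | j) <;> simp [harmonicField] <;> ring }
  exact (L.toContinuousLinearMap.isBigO_id (𝓝 0)).norm_right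

theorem fderiv_harmonicField_isBigO (ω : Fin n → ℝ) {m : ℕ} (hm : 1 ≤ m) {G : Phase n → ℝ}
    (hG : G ∈ powerSpan (Phase n) m) :
    (fun z => fderiv ℝ G z (harmonicField ω z)) =O[𝓝 0] fun z => ‖z‖ ^ m := by
  obtain ⟨k, rfl⟩ : ∃ k, m = k + 1 := ⟨m - 1, by omega⟩
  have h1 : (fun z => fderiv ℝ G z (harmonicField ω z)) =O[𝓝 0]
      fun z => ‖fderiv ℝ G z‖ * ‖harmonicField ω z‖ :=
    IsBigO.of_bound 1 (Eventually.of_forall fun z => by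
      simpa using (fderiv ℝ G z).le_opNorm (harmonicField ω z))
  refine (h1.trans ((fderiv_isBigO_of_mem_powerSpan hG (𝓝 0)).norm_left.mul
    (harmonicField_isBigO ω).norm_left)).congr_right fun z => ?_
  ring

theorem contDiff_harmonic (ω : Fin n → ℝ) {k : WithTop ℕ∞} :
    ContDiff ℝ k (harmonic ω : Phase n → ℝ) := by
  unfold harmonic action
  fun_prop

/-- A homogeneous polynomial `G` generates a canonical transformation which changes Hamiltonians
with quadratic part `H₀` by `{H₀, G}` up to higher order. -/
theorem exists_canonical_generated (ω : Fin n → ℝ) {m : ℕ} (hm : 3 ≤ m) {G : Phase n → ℝ}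
    (hG : G ∈ powerSpan (Phase n) m) :
    ∃ e : Phase n ≃ₜ Phase n, IsGlobalCanonical e ∧
      ∀ f : Phase n → ℝ, ContDiffAt ℝ (⊤ : ℕ∞) f 0 →
        (fun z => f z - harmonic ω z) =O[𝓝 0] (fun z => ‖z‖ ^ 3) →
        (fun z => f (e z) - f z + fderiv ℝ G z (harmonicField ω z)) =O[𝓝 0]
          fun z => ‖z‖ ^ (m + 1) := by
  -- The claim covers every f with quadratic part H₀ so that it survives composition: `f ∘ e₁` has
  -- the same quadratic part, and the two corrections add up modulo degree m + 1.
  induction hG using Submodule.closure_induction with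
  | zero => exact ⟨Homeomorph.refl _, .refl, fun f _ _ => by simpa using isBigO_zero _ _⟩
  | add G₁ G₂ hG₁ hG₂ h₁ h₂ =>
    obtain ⟨e₁, he₁, h₁⟩ := h₁
    obtain ⟨e₂, he₂, h₂⟩ := h₂
    refine ⟨e₂.trans e₁, he₂.trans he₁, fun f hf hf3 => ?_⟩
    have hs : ContDiffAt ℝ (⊤ : ℕ∞) (fun z => f (e₁ z)) 0 := by
      refine ContDiffAt.comp 0 ?_ he₁.contDiff.contDiffAt
      rwa [he₁.map_zero]
    have h3 : (fun z => f (e₁ z) - harmonic ω z) =O[𝓝 0] (fun z => ‖z‖ ^ 3) := by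
      have ha := (h₁ f hf hf3).trans (isBigO_norm_pow_of_le (show 3 ≤ m + 1 by omega))
      have hb := (fderiv_harmonicField_isBigO ω (by omega) hG₁).trans (isBigO_norm_pow_of_le hm)
      refine ((ha.sub hb).add hf3).congr_left fun z => ?_
      ring
    refine ((h₁ f hf hf3).add (h₂ _ hs h3)).congr_left fun z => ?_
    rw [fderiv_add ((contDiff_of_mem_powerSpan hG₁ (k := 1)).differentiable one_ne_zero z)
      ((contDiff_of_mem_powerSpan hG₂ (k := 1)).differentiable one_ne_zero z)]
    simp only [add_apply, Homeomorph.trans_apply]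
    ring
  | smul_mem c G hG =>
    obtain ⟨ℓ, rfl⟩ := hG
    -- The field of the Hamiltonian c ℓ^m is c m ℓ^(m-1) times `hamVector ℓ`; this is its time-one
    -- map.
    refine ⟨shearHomeomorph ℓ (c * m) (m - 1), isGlobalCanonical_shear _ _ (by omega),
      fun f hf hf3 => ?_⟩
    have hQ := comp_sub_isBigO (hf.sub (contDiff_harmonic ω).contDiffAt) hf3 (show 1 ≤ m - 1 by omega)
      (shear_sub_isBigO ℓ (c * m) (m - 1))
    rw [show m - 1 + 2 = m + 1 by omega] at hQ
    have ha : (fun z => c * m * ℓ z ^ (m - 1)) =O[𝓝 0] fun z => ‖z‖ ^ (m - 1) :=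
      (((ℓ.isBigO_id _).norm_right).pow (m - 1)).const_mul_left _
    -- The second-order term has order 2(m - 1), which is at least m + 1 because m ≥ 3.
    have ha2 : (fun z => (c * m * ℓ z ^ (m - 1)) ^ 2 * harmonic ω (hamVector ℓ)) =O[𝓝 0]
        fun z => ‖z‖ ^ (m + 1) := by
      have h := (ha.pow 2).mul (isBigO_const_const (harmonic ω (hamVector ℓ)) (one_ne_zero (α := ℝ))
        (𝓝 (0 : Phase n)))
      simp only [← pow_mul, mul_one] at h
      simp only [pow_mul] at h ⊢
      refine IsBigO.trans ?_ (isBigO_norm_pow_of_le (show m + 1 ≤ (m - 1) * 2 by omega))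
      simpa only [pow_mul] using h
    refine (hQ.add ha2).congr_left fun z => ?_
    have hd : fderiv ℝ (c • fun z : Phase n => ℓ z ^ m) z
        = (c * (m * ℓ z ^ (m - 1))) • ℓ := by
      have := (HasFDerivAt.pow (ℓ.hasFDerivAt (x := z)) m).const_smul c
      refine (this.fderiv).trans ?_
      ext v
      simp
      ring
    have he : shearHomeomorph ℓ (c * m) (m - 1) z
        = z + (c * m * ℓ z ^ (m - 1)) • hamVector ℓ := rfl
    have he' : shear ℓ (c * m) (m - 1) z
        = z + (c * m * ℓ z ^ (m - 1)) • hamVector ℓ := rfl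
    rw [hd, he, he', harmonic_add_smul_hamVector]
    simp only [smul_apply, smul_eq_mul]
    ring

/-- Birkhoff normal form of arbitrary order. -/
theorem exists_normalization {ω : Fin n → ℝ} (hω : NonResonant ω) {H : Phase n → ℝ}
    (hH : ContDiffAt ℝ (⊤ : ℕ∞) H 0)
    (hH3 : (fun z => H z - harmonic ω z) =O[𝓝 0] fun z => ‖z‖ ^ 3) (N : ℕ) (hN : 2 ≤ N) :
    ∃ e : Phase n ≃ₜ Phase n, IsGlobalCanonical e ∧
      (fun z => H (e z) - harmonic ω z) =O[𝓝 0] (fun z => ‖z‖ ^ 3) ∧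
      ∃ Z : ℕ → MvPolynomial (Fin n) ℝ, (∀ m, 2 * (Z m).totalDegree ≤ m) ∧
        (∀ m, (fun z => MvPolynomial.eval (fun j => action j z) (Z m)) ∈ powerSpan (Phase n) m) ∧
        (fun z => H (e z) - harmonic ω z - ∑ m ∈ Finset.range (N + 1),
          MvPolynomial.eval (fun j => action j z) (Z m)) =O[𝓝 0] fun z => ‖z‖ ^ (N + 1) := by
  induction N, hN using Nat.le_induction with
  | base =>
    refine ⟨Homeomorph.refl _, .refl, hH3, 0, by simp, fun m => ?_, ?_⟩
    · simp only [Pi.zero_apply, map_zero]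
      exact Submodule.zero_mem _
    · simpa using hH3
  | succ N hN ih =>
    obtain ⟨e, he, he3, Z, hZdeg, hZmem, hZO⟩ := ih
    have hf : ContDiffAt ℝ (⊤ : ℕ∞) (fun z => H (e z)) 0 := by
      refine ContDiffAt.comp 0 ?_ he.contDiff.contDiffAt
      rwa [he.map_zero]
    have hR := (hf.sub (contDiff_harmonic ω).contDiffAt).sub (ContDiff.sum (s := Finset.range (N + 1))
      fun m _ => contDiff_of_mem_powerSpan (hZmem m) (k := (⊤ : ℕ∞))).contDiffAt
    -- Expanding the remainder from degree N + 1 up to, but excluding, N + 2 leaves the single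
    -- homogeneous term to be normalized.
    obtain ⟨T, hT, -, hTO⟩ := exists_leading_part hR hZO (N + 1 + 1) (by omega)
    simp only [Nat.Ico_succ_singleton, Finset.sum_singleton] at hTO
    obtain ⟨G, hG, Z', hZ'deg, hZ'mem, hsol⟩ := hasHomologicalSolution hω (hT (N + 1))
    obtain ⟨σ, hσ, hσf⟩ := exists_canonical_generated ω (by omega) hG
    have hσO := hσf _ hf he3
    have hGO := fderiv_harmonicField_isBigO ω (by omega) hG
    refine ⟨σ.trans e, hσ.trans he, ?_, Function.update Z (N + 1) Z', ?_, ?_, ?_⟩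
    · have h1 := hσO.trans (isBigO_norm_pow_of_le (show 3 ≤ N + 1 + 1 by omega))
      have h2 := hGO.trans (isBigO_norm_pow_of_le (show 3 ≤ N + 1 by omega))
      refine ((h1.sub h2).add he3).congr_left fun z => ?_
      simp only [Homeomorph.trans_apply]
      ring
    · intro m
      rcases eq_or_ne m (N + 1) with rfl | hm
      · simpa using hZ'deg
      · simpa [hm] using hZdeg m
    · intro m
      rcases eq_or_ne m (N + 1) with rfl | hm
      · simpa using hZ'mem
      · simpa [hm] using hZmem m
    · refine (hTO.add hσO).congr_left fun z => ?_
      rw [Finset.sum_range_succ _ (N + 1), Function.update_self, ← hsol z]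
      have : ∑ m ∈ Finset.range (N + 1), MvPolynomial.eval (fun j => action j z)
          (Function.update Z (N + 1) Z' m)
          = ∑ m ∈ Finset.range (N + 1), MvPolynomial.eval (fun j => action j z) (Z m) :=
        Finset.sum_congr rfl fun m hm => by
          rw [Function.update_of_ne (Finset.mem_range.1 hm).ne]
      rw [this]
      simp only [Homeomorph.trans_apply]
      ring

end Canonical

/-! ### Actions, their brackets, and distances to tori. -/

section Actions

variable {n : ℕ}

theorem hasFDerivAt_action (j : Fin n) (z : Phase n) :
    HasFDerivAt (action j)
      (z (Sum.inr j) • (EuclideanSpace.proj (Sum.inr j) : Phase n →L[ℝ] ℝ)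
        + z (Sum.inl j) • (EuclideanSpace.proj (Sum.inl j) : Phase n →L[ℝ] ℝ)) z := by
  have hp := ((EuclideanSpace.proj (Sum.inr j) : Phase n →L[ℝ] ℝ).hasFDerivAt (x := z)).pow 2
  have hq := ((EuclideanSpace.proj (Sum.inl j) : Phase n →L[ℝ] ℝ).hasFDerivAt (x := z)).pow 2
  refine ((hp.add hq).mul_const (2⁻¹ : ℝ)).congr_fderiv ?_
  ext v
  simp
  ring

theorem contDiff_action (j : Fin n) {k : WithTop ℕ∞} :
    ContDiff ℝ k (action j : Phase n → ℝ) := by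
  unfold action
  fun_prop

theorem fderiv_action_apply (j : Fin n) (z v : Phase n) :
    fderiv ℝ (action j) z v = z (Sum.inr j) * v (Sum.inr j) + z (Sum.inl j) * v (Sum.inl j) := by
  rw [(hasFDerivAt_action j z).fderiv]
  simp

theorem poissonForm_fderiv_action (j : Fin n) (z : Phase n) (β : Phase n →L[ℝ] ℝ) :
    poissonForm (fderiv ℝ (action j) z) β
      = z (Sum.inl j) * β (EuclideanSpace.single (Sum.inr j) 1)
        - z (Sum.inr j) * β (EuclideanSpace.single (Sum.inl j) 1) := by
  simp only [poissonForm, fderiv_action_apply]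
  rw [Finset.sum_eq_single j]
  · simp
  · intro i _ hij
    simp [hij.symm]
  · simp

theorem norm_sq_eq_sum_action (z : Phase n) : ‖z‖ ^ 2 = ∑ j, 2 * action j z := by
  rw [EuclideanSpace.real_norm_sq_eq, Fintype.sum_sum_type, ← Finset.sum_add_distrib]
  refine Finset.sum_congr rfl fun j _ => ?_
  rw [action]
  ring

theorem action_nonneg (j : Fin n) (z : Phase n) : 0 ≤ action j z := by
  rw [action]
  positivity

/-- The factor √I_j is essential: after division by the radius it gives a speed bound for the radius
that does not degenerate as I_j tends to 0. -/
theorem abs_poissonForm_action_le (j : Fin n) (z : Phase n) (β : Phase n →L[ℝ] ℝ) :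
    |poissonForm (fderiv ℝ (action j) z) β| ≤ 2 * √(2 * action j z) * ‖β‖ := by
  have hβ : ∀ s, |β (EuclideanSpace.single s 1)| ≤ ‖β‖ := fun s => by
    simpa using β.le_opNorm (EuclideanSpace.single s 1)
  have hq : |z (Sum.inl j)| ≤ √(2 * action j z) :=
    Real.abs_le_sqrt (by rw [action]; nlinarith [sq_nonneg (z (Sum.inr j))])
  have hp : |z (Sum.inr j)| ≤ √(2 * action j z) :=
    Real.abs_le_sqrt (by rw [action]; nlinarith [sq_nonneg (z (Sum.inl j))])
  rw [poissonForm_fderiv_action]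
  calc _ ≤ |z (Sum.inl j)| * |β (EuclideanSpace.single (Sum.inr j) 1)|
        + |z (Sum.inr j)| * |β (EuclideanSpace.single (Sum.inl j) 1)| := by
        rw [← abs_mul, ← abs_mul]
        exact abs_sub _ _
    _ ≤ √(2 * action j z) * ‖β‖ + √(2 * action j z) * ‖β‖ := by
        gcongr
        exacts [hβ _, hβ _]
    _ = _ := by ring

theorem contDiff_eval_action (Φ : MvPolynomial (Fin n) ℝ) {k : WithTop ℕ∞} :
    ContDiff ℝ k (fun z : Phase n => MvPolynomial.eval (fun j => action j z) Φ) := by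
  induction Φ using MvPolynomial.induction_on with
  | C a => simpa using contDiff_const
  | add p q hp hq => simpa using hp.add hq
  | mul_X p j hp => simpa using hp.mul (contDiff_action j)

theorem fderiv_eval_action_apply_eq_zero (Φ : MvPolynomial (Fin n) ℝ) {z v : Phase n}
    (hv : ∀ j, fderiv ℝ (action j) z v = 0) :
    fderiv ℝ (fun z : Phase n => MvPolynomial.eval (fun j => action j z) Φ) z v = 0 := by
  have hd : ∀ p : MvPolynomial (Fin n) ℝ, DifferentiableAt ℝ
      (fun z : Phase n => MvPolynomial.eval (fun j => action j z) p) z := fun p =>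
    (contDiff_eval_action p (k := 1)).differentiable one_ne_zero z
  induction Φ using MvPolynomial.induction_on with
  | C a => simp
  | add p q hp hq =>
    simp only [map_add]
    rw [fderiv_fun_add (hd p) (hd q), add_apply, hp, hq, add_zero]
  | mul_X p j hp =>
    simp only [map_mul, MvPolynomial.eval_X]
    rw [fderiv_fun_mul (hd p) ((contDiff_action j (k := 1)).differentiable one_ne_zero z)]
    simp [hp, hv]

/-- Functions of the actions Poisson commute with the actions. -/
theorem poissonForm_action_eval_action (j : Fin n) (Φ : MvPolynomial (Fin n) ℝ) (z : Phase n) :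
    poissonForm (fderiv ℝ (action j) z)
      (fderiv ℝ (fun z : Phase n => MvPolynomial.eval (fun j => action j z) Φ) z) = 0 := by
  rw [poissonForm_swap, ← apply_hamVector, fderiv_eval_action_apply_eq_zero, neg_zero]
  intro k
  rw [apply_hamVector, poissonForm_fderiv_action, fderiv_action_apply, fderiv_action_apply]
  rcases eq_or_ne j k with rfl | hjk
  · simp
    ring
  · simp [hjk]

/-- Radial projection; at the centre any point of the circle will do. -/
theorem exists_on_circle (q p R : ℝ) :
    ∃ a b : ℝ, b ^ 2 + a ^ 2 = R ^ 2 ∧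
      (q - a) ^ 2 + (p - b) ^ 2 = (√(p ^ 2 + q ^ 2) - R) ^ 2 := by
  rcases (add_nonneg (sq_nonneg p) (sq_nonneg q)).eq_or_lt' with h | h
  · have hq : q = 0 := by nlinarith [sq_nonneg p, sq_nonneg q]
    have hp : p = 0 := by nlinarith [sq_nonneg p, sq_nonneg q]
    refine ⟨R, 0, by ring, ?_⟩
    simp [hq, hp]
  · set ρ := √(p ^ 2 + q ^ 2) with hρ
    have hρ0 : 0 < ρ := Real.sqrt_pos.2 h
    have hρ2 : ρ ^ 2 = p ^ 2 + q ^ 2 := Real.sq_sqrt h.le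
    refine ⟨R / ρ * q, R / ρ * p, ?_, ?_⟩
    · have : (R / ρ * p) ^ 2 + (R / ρ * q) ^ 2 = (R / ρ) ^ 2 * ρ ^ 2 := by rw [hρ2]; ring
      rw [this]
      field_simp
    · have : (q - R / ρ * q) ^ 2 + (p - R / ρ * p) ^ 2 = (1 - R / ρ) ^ 2 * ρ ^ 2 := by
        rw [hρ2]; ring
      rw [this, ← mul_pow]
      congr 1
      field_simp

/-- The distance of a point to a torus is controlled by the differences of the radii. -/
theorem exists_mem_actionTorus (w w₀ : Phase n) :
    ∃ x ∈ actionTorus (fun j => action j w₀),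
      ‖w - x‖ ≤ ∑ j, |√(2 * action j w) - √(2 * action j w₀)| := by
  choose a b hab hd using fun j =>
    exists_on_circle (w (Sum.inl j)) (w (Sum.inr j)) (√(2 * action j w₀))
  refine ⟨WithLp.toLp 2 (Sum.elim a b), fun j => ?_, ?_⟩
  · have := hab j
    rw [Real.sq_sqrt (mul_nonneg zero_le_two (action_nonneg _ _))] at this
    rw [action]
    simp only [Sum.elim_inl, Sum.elim_inr]
    linarith
  · have h0 : 0 ≤ ∑ j, |√(2 * action j w) - √(2 * action j w₀)| :=
      Finset.sum_nonneg fun _ _ => abs_nonneg _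
    refine (sq_le_sq₀ (norm_nonneg _) h0).1 ?_
    have h1 : ‖w - WithLp.toLp 2 (Sum.elim a b)‖ ^ 2
        = ∑ j, |√(2 * action j w) - √(2 * action j w₀)| ^ 2 := by
      rw [EuclideanSpace.real_norm_sq_eq, Fintype.sum_sum_type, ← Finset.sum_add_distrib]
      refine Finset.sum_congr rfl fun j _ => ?_
      have e : 2 * action j w = w (Sum.inr j) ^ 2 + w (Sum.inl j) ^ 2 := by rw [action]; ring
      rw [sq_abs, e, ← hd j]
      simp
    rw [h1]
    exact Finset.sum_sq_le_sq_sum_of_nonneg fun _ _ => abs_nonneg _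

theorem norm_eq_of_mem_actionTorus {w x : Phase n}
    (hx : x ∈ actionTorus (fun j => action j w)) : ‖x‖ = ‖w‖ := by
  refine (pow_left_inj₀ (norm_nonneg _) (norm_nonneg _) two_ne_zero).1 ?_
  rw [norm_sq_eq_sum_action, norm_sq_eq_sum_action]
  exact Finset.sum_congr rfl fun j _ => by rw [hx j]

end Actions

/-- If `|u'| ≤ 2 B √u` then `√u` is `B`-Lipschitz. -/
theorem abs_sqrt_sub_sqrt_le {u u' : ℝ → ℝ} {B b : ℝ}
    (hu : ∀ s ∈ Set.Icc 0 b, HasDerivWithinAt u (u' s) (Set.Icc 0 b) s)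
    (hnn : ∀ s ∈ Set.Icc 0 b, 0 ≤ u s) (hB : 0 ≤ B)
    (hb : ∀ s ∈ Set.Icc 0 b, |u' s| ≤ 2 * B * √(u s)) {x : ℝ} (hx : x ∈ Set.Icc 0 b) :
    |√(u x) - √(u 0)| ≤ B * x := by
  have h0 : (0 : ℝ) ∈ Set.Icc 0 b := ⟨le_rfl, hx.1.trans hx.2⟩
  -- The square root is not differentiable at 0, so u is shifted by η; the bound is uniform in η,
  -- which then tends to 0.
  have key : ∀ η > 0, |√(u x + η) - √(u 0 + η)| ≤ B * x := by
    intro η hη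
    have hd : ∀ s ∈ Set.Icc 0 b, HasDerivWithinAt (fun s => √(u s + η))
        (u' s / (2 * √(u s + η))) (Set.Icc 0 b) s := fun s hs =>
      ((hu s hs).add_const η).sqrt (by have := hnn s hs; positivity)
    have h := norm_image_sub_le_of_norm_deriv_le_segment' hd (C := B) (fun s hs => ?_) x hx
    · simpa using h
    · have hs' : s ∈ Set.Icc 0 b := ⟨hs.1, hs.2.le⟩
      have hpos : 0 < √(u s + η) := Real.sqrt_pos.2 (by have := hnn s hs'; positivity)
      rw [Real.norm_eq_abs, abs_div, abs_of_pos (show 0 < 2 * √(u s + η) by positivity),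
        div_le_iff₀ (by positivity)]
      calc |u' s| ≤ 2 * B * √(u s) := hb s hs'
        _ ≤ 2 * B * √(u s + η) := by
          gcongr
          linarith
        _ = B * (2 * √(u s + η)) := by ring
  have hcont : Continuous fun η : ℝ => |√(u x + η) - √(u 0 + η)| := by fun_prop
  have ht := (hcont.tendsto 0).mono_left (nhdsWithin_le_nhds (s := Set.Ioi 0))
  simp only [add_zero] at ht
  exact le_of_tendsto ht (by filter_upwards [self_mem_nhdsWithin] with η hη using key η hη)

/-! ### Drift of the normalized actions and the bootstrap. -/

section Dynamics

variable {n : ℕ}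

/-- The evolution of the normalized actions is driven by the remainder only. -/
theorem hasDerivWithinAt_normalized_action {H R : Phase n → ℝ} {Φ : MvPolynomial (Fin n) ℝ}
    {e : Phase n ≃ₜ Phase n} (he : IsGlobalCanonical e)
    (hR : ∀ z, H (e z) = MvPolynomial.eval (fun j => action j z) Φ + R z)
    {γ : ℝ → Phase n} {S : Set ℝ} {c s : ℝ} (hH : DifferentiableAt ℝ H (γ s))
    (hγ : HasDerivWithinAt γ (c • hamVectorField H (γ s)) S s) (j : Fin n) :
    HasDerivWithinAt (fun s => 2 * action j (e.symm (γ s)))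
      (2 * (c * poissonForm (fderiv ℝ (action j) (e.symm (γ s))) (fderiv ℝ R (e.symm (γ s)))))
      S s := by
  set w := e.symm (γ s) with hw
  have hew : e w = γ s := e.apply_symm_apply _
  have hde : DifferentiableAt ℝ e w := he.contDiff.differentiable one_ne_zero w
  have hA : DifferentiableAt ℝ (fun z => action j (e.symm z)) (γ s) :=
    ((contDiff_action j (k := 1)).comp he.contDiff_symm).differentiable one_ne_zero _
  have hHe : DifferentiableAt ℝ (fun z => H (e z)) w := by
    refine DifferentiableAt.comp w ?_ hde
    rwa [hew]
  have hN : DifferentiableAt ℝ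
      (fun z : Phase n => MvPolynomial.eval (fun j => action j z) Φ) w :=
    (contDiff_eval_action Φ (k := 1)).differentiable one_ne_zero w
  have hRd : fderiv ℝ (fun z => H (e z)) w
      = fderiv ℝ (fun z : Phase n => MvPolynomial.eval (fun j => action j z) Φ) w
        + fderiv ℝ R w := by
    have : R = fun z => H (e z) - MvPolynomial.eval (fun j => action j z) Φ := by
      funext z
      rw [hR]
      ring
    rw [this, fderiv_fun_sub hHe hN]
    abel
  have h1 : (fderiv ℝ H (γ s)).comp (fderiv ℝ e w) = fderiv ℝ (fun z => H (e z)) w := by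
    rw [← hew] at hH ⊢
    exact (fderiv_comp w hH hde).symm
  have h2 : (fderiv ℝ (fun z => action j (e.symm z)) (γ s)).comp (fderiv ℝ e w)
      = fderiv ℝ (action j) w := by
    rw [← hew] at hA ⊢
    rw [← fderiv_comp w hA hde]
    congr 1
    funext z
    simp
  -- Both covectors are pulled back by the symplectic derivative of e; in the new coordinates Φ(I)
  -- drops out of the bracket and only R remains.
  have h3 : fderiv ℝ (fun z => action j (e.symm z)) (γ s) (hamVectorField H (γ s))
      = poissonForm (fderiv ℝ (action j) w) (fderiv ℝ R w) := by
    rw [hamVectorField_eq_hamVector, apply_hamVector, ← he.poisson w, h1, h2, hRd]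
    have hadd : ∀ α β β' : Phase n →L[ℝ] ℝ,
        poissonForm α (β + β') = poissonForm α β + poissonForm α β' := fun α β β' => by
      simp only [poissonForm, ← Finset.sum_add_distrib, add_apply]
      exact Finset.sum_congr rfl fun _ _ => by ring
    rw [hadd, poissonForm_action_eval_action, zero_add]
  have h4 := (hA.hasFDerivAt.comp_hasDerivWithinAt s hγ).const_mul 2
  rw [map_smul, h3, smul_eq_mul] at h4
  exact h4

/-- The radius of a ball on which the normalizing transformation and the remainder of the normal
form are under control. -/
structure IsControlRadius (H R : Phase n → ℝ) (e : Phase n ≃ₜ Phase n) (N : ℕ) (K L δ : ℝ) :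
    Prop where
  pos : 0 < δ
  differentiable : ∀ z, ‖z‖ < δ → DifferentiableAt ℝ H z
  norm_symm_le : ∀ z, ‖z‖ < δ → ‖e.symm z‖ ≤ 2 * ‖z‖
  norm_le : ∀ z, ‖z‖ < δ → ‖e z‖ ≤ 2 * ‖z‖
  lipschitz : ∀ z w, ‖z‖ < δ → ‖w‖ < δ → ‖e z - e w‖ ≤ L * ‖z - w‖
  remainder : ∀ z, ‖z‖ < δ → ‖fderiv ℝ R z‖ ≤ K * ‖z‖ ^ N

theorem IsControlRadius.mono {H R : Phase n → ℝ} {e : Phase n ≃ₜ Phase n} {N : ℕ} {K L δ δ' : ℝ}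
    (h : IsControlRadius H R e N K L δ) (hpos : 0 < δ') (hle : δ' ≤ δ) :
    IsControlRadius H R e N K L δ' where
  pos := hpos
  differentiable z hz := h.differentiable z (hz.trans_le hle)
  norm_symm_le z hz := h.norm_symm_le z (hz.trans_le hle)
  norm_le z hz := h.norm_le z (hz.trans_le hle)
  lipschitz z w hz hw := h.lipschitz z w (hz.trans_le hle) (hw.trans_le hle)
  remainder z hz := h.remainder z (hz.trans_le hle)

theorem exists_isControlRadius {H R : Phase n → ℝ} {e : Phase n ≃ₜ Phase n}
    (he : IsGlobalCanonical e) {N : ℕ} (hH : ContDiffAt ℝ (⊤ : ℕ∞) H 0)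
    (hRs : ContDiffAt ℝ (⊤ : ℕ∞) R 0) (hR : R =O[𝓝 0] fun z => ‖z‖ ^ (N + 1)) :
    ∃ K L δ : ℝ, 0 ≤ K ∧ 0 ≤ L ∧ IsControlRadius H R e N K L δ := by
  obtain ⟨K, hK0, hK⟩ := (fderiv_isBigO hRs hR).exists_pos
  rw [IsBigOWith] at hK
  obtain ⟨L, s, hs, hL⟩ := (he.contDiff (k := 1)).contDiffAt (x := 0).exists_lipschitzOnWith
  have hdiff : ∀ᶠ z in 𝓝 (0 : Phase n), DifferentiableAt ℝ H z :=
    ((hH.of_le (m := 1) (by simp)).eventually (by simp)).mono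
      fun z hz => hz.differentiableAt one_ne_zero
  -- A relative error of 1/2 yields the factor 2 in the bounds for both e and its inverse.
  have hclose : ∀ᶠ z in 𝓝 (0 : Phase n), ‖e z - z‖ ≤ 2⁻¹ * ‖z‖ := by
    obtain ⟨C, hC0, hC⟩ := he.near_id.exists_pos
    rw [IsBigOWith] at hC
    filter_upwards [hC, Metric.ball_mem_nhds 0 (show 0 < (2 * C)⁻¹ by positivity)] with z h1 h2
    rw [mem_ball_zero_iff] at h2
    rw [norm_pow, norm_norm] at h1
    have h3 : C * ‖z‖ ≤ 2⁻¹ := by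
      calc C * ‖z‖ ≤ C * (2 * C)⁻¹ := by gcongr
        _ = 2⁻¹ := by field_simp
    nlinarith [norm_nonneg z]
  have hsymm : Tendsto e.symm (𝓝 0) (𝓝 0) := by
    have h := e.symm.continuous.tendsto 0
    rwa [show e.symm 0 = 0 by rw [Homeomorph.symm_apply_eq, he.map_zero]] at h
  obtain ⟨δ, hδ, hball⟩ := Metric.eventually_nhds_iff_ball.1
    ((((hK.and hdiff).and hs).and hclose).and (hsymm.eventually hclose))
  simp only [mem_ball_zero_iff] at hball
  refine ⟨K, L, δ, hK0.le, L.2, hδ, fun z hz => (hball z hz).1.1.1.2, fun z hz => ?_,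
    fun z hz => ?_, fun z w hz hw => ?_, fun z hz => ?_⟩
  · have h := (hball z hz).2
    rw [Homeomorph.apply_symm_apply] at h
    have := norm_sub_norm_le (e.symm z) z
    rw [norm_sub_rev] at this
    linarith
  · have h := (hball z hz).1.2
    have := norm_sub_norm_le (e z) z
    linarith [norm_nonneg z]
  · exact hL.norm_sub_le (hball z hz).1.1.2 (hball w hw).1.1.2
  · simpa using (hball z hz).1.1.1.1

/-- As long as an orbit stays in a small ball, it stays close to its normalized torus. -/
theorem exists_torus_point_of_forall_norm_le {H R : Phase n → ℝ} {Φ : MvPolynomial (Fin n) ℝ}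
    {e : Phase n ≃ₜ Phase n} (he : IsGlobalCanonical e)
    (hR : ∀ z, H (e z) = MvPolynomial.eval (fun j => action j z) Φ + R z)
    {N : ℕ} {K L δ : ℝ} (hK : 0 ≤ K) (hδ : IsControlRadius H R e N K L δ)
    {ε b c : ℝ} (hεδ : 14 * ε < δ) (hc : |c| ≤ 1) {γ : ℝ → Phase n}
    (hγ : ∀ s ∈ Set.Icc 0 b, HasDerivWithinAt γ (c • hamVectorField H (γ s)) (Set.Icc 0 b) s)
    (hle : ∀ s ∈ Set.Icc 0 b, ‖γ s‖ ≤ 7 * ε) {x : ℝ} (hx : x ∈ Set.Icc 0 b) :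
    ∃ w ∈ actionTorus (fun j => action j (e.symm (γ 0))),
      ‖e.symm (γ x) - w‖ ≤ n * (2 * (K * (14 * ε) ^ N)) * x := by
  have hε : 0 ≤ ε := by
    have := (norm_nonneg _).trans (hle x hx)
    linarith
  have hγδ : ∀ s ∈ Set.Icc 0 b, ‖γ s‖ < δ := fun s hs => by
    have := hle s hs
    linarith
  -- 14 = 2 · 7: passing to normalized coordinates at most doubles the norm.
  have hwle : ∀ s ∈ Set.Icc 0 b, ‖e.symm (γ s)‖ ≤ 14 * ε := fun s hs => by
    have h1 := hδ.norm_symm_le _ (hγδ s hs)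
    have h2 := hle s hs
    linarith
  obtain ⟨w, hw, hwd⟩ := exists_mem_actionTorus (e.symm (γ x)) (e.symm (γ 0))
  refine ⟨w, hw, hwd.trans ?_⟩
  have hj : ∀ j, |√(2 * action j (e.symm (γ x))) - √(2 * action j (e.symm (γ 0)))|
      ≤ 2 * (K * (14 * ε) ^ N) * x := by
    intro j
    refine abs_sqrt_sub_sqrt_le (u := fun s => 2 * action j (e.symm (γ s)))
      (fun s hs => hasDerivWithinAt_normalized_action he hR (hδ.differentiable _ (hγδ s hs))
        (hγ s hs) j) (fun s _ => mul_nonneg zero_le_two (action_nonneg _ _)) (by positivity)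
      (fun s hs => ?_) hx
    have h1 := abs_poissonForm_action_le j (e.symm (γ s)) (fderiv ℝ R (e.symm (γ s)))
    have h2 : ‖fderiv ℝ R (e.symm (γ s))‖ ≤ K * (14 * ε) ^ N := by
      refine (hδ.remainder _ ((hwle s hs).trans_lt hεδ)).trans ?_
      gcongr
      exact hwle s hs
    rw [abs_mul, abs_mul, abs_two]
    calc 2 * (|c| * |poissonForm (fderiv ℝ (action j) (e.symm (γ s)))
          (fderiv ℝ R (e.symm (γ s)))|)
        ≤ 2 * (1 * (2 * √(2 * action j (e.symm (γ s))) * (K * (14 * ε) ^ N))) := by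
          gcongr
          exact h1.trans (by gcongr)
      _ = 2 * (2 * (K * (14 * ε) ^ N)) * √(2 * action j (e.symm (γ s))) := by ring
  calc _ ≤ ∑ _j : Fin n, 2 * (K * (14 * ε) ^ N) * x := Finset.sum_le_sum fun j _ => hj j
    _ = n * (2 * (K * (14 * ε) ^ N)) * x := by
      simp
      ring

/-- A continuous function that starts below a level and reaches it has a first hitting time. -/
theorem exists_first_hit {g : ℝ → ℝ} {b a : ℝ} (hg : ContinuousOn g (Set.Icc 0 b)) (h0 : g 0 < a)
    {x : ℝ} (hx : x ∈ Set.Icc 0 b) (hxa : a ≤ g x) :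
    ∃ s ∈ Set.Icc 0 b, g s = a ∧ ∀ t ∈ Set.Icc 0 s, g t ≤ a := by
  have hsub : ∀ y ∈ Set.Icc 0 b, Set.Icc 0 y ⊆ Set.Icc 0 b := fun y hy =>
    Set.Icc_subset_Icc_right hy.2
  have hivt : ∀ y ∈ Set.Icc 0 b, a ≤ g y → ∃ s ∈ Set.Icc 0 y, g s = a := fun y hy hya =>
    intermediate_value_Icc hy.1 (hg.mono (hsub y hy)) ⟨h0.le, hya⟩
  have hcomp : IsCompact (Set.Icc 0 b ∩ g ⁻¹' {a}) :=
    isCompact_Icc.of_isClosed_subset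
      (hg.preimage_isClosed_of_isClosed isClosed_Icc isClosed_singleton) Set.inter_subset_left
  have hne : (Set.Icc 0 b ∩ g ⁻¹' {a}).Nonempty := by
    obtain ⟨s, hs, hsa⟩ := hivt x hx hxa
    exact ⟨s, hsub x hx hs, hsa⟩
  obtain ⟨s, ⟨hs, hsa⟩, hleast⟩ := hcomp.exists_isLeast hne
  refine ⟨s, hs, hsa, fun t ht => ?_⟩
  by_contra hlt
  obtain ⟨t', ht', hta⟩ := hivt t (hsub s hs ht) (not_le.1 hlt).le
  have h1 : s ≤ t' := hleast ⟨hsub t (hsub s hs ht) ht', hta⟩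
  have h2 : t = s := le_antisymm ht.2 (h1.trans ht'.2)
  exact hlt (h2 ▸ hsa.le)

/-- The bootstrap: on the stability time scale orbits do not leave a small ball. -/
theorem norm_lt_of_short_time {H R : Phase n → ℝ} {Φ : MvPolynomial (Fin n) ℝ}
    {e : Phase n ≃ₜ Phase n} (he : IsGlobalCanonical e)
    (hR : ∀ z, H (e z) = MvPolynomial.eval (fun j => action j z) Φ + R z)
    {N : ℕ} {K L δ : ℝ} (hK : 0 ≤ K) (hδ : IsControlRadius H R e N K L δ)
    {ε b c : ℝ} (hε : 0 < ε) (hεδ : 14 * ε < δ) (hc : |c| ≤ 1)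
    (hb : n * (2 * (K * (14 * ε) ^ N)) * b ≤ ε) {γ : ℝ → Phase n}
    (hcont : ContinuousOn γ (Set.Icc 0 b)) (h0 : ‖γ 0‖ ≤ ε)
    (hγ : ∀ s ∈ Set.Icc 0 b, ‖γ s‖ ≤ 7 * ε →
      HasDerivWithinAt γ (c • hamVectorField H (γ s)) (Set.Icc 0 b) s)
    {x : ℝ} (hx : x ∈ Set.Icc 0 b) : ‖γ x‖ < 7 * ε := by
  by_contra hlt
  -- At the first time of norm 7ε, the normalized torus has norm at most 2ε and the drift is at most
  -- ε. The normalized point thus has norm at most 3ε, and mapping back by e gives at most 6ε, a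
  -- contradiction.
  obtain ⟨s, hs, hsa, hle⟩ := exists_first_hit hcont.norm (show ‖γ 0‖ < 7 * ε by linarith) hx
    (not_lt.1 hlt)
  have hsub : Set.Icc 0 s ⊆ Set.Icc 0 b := Set.Icc_subset_Icc_right hs.2
  obtain ⟨w, hw, hwd⟩ := exists_torus_point_of_forall_norm_le he hR hK hδ hεδ hc
    (fun t ht => (hγ t (hsub ht) (hle t ht)).mono hsub) hle (Set.right_mem_Icc.2 hs.1)
  have h1 : ‖w‖ ≤ 2 * ε := by
    rw [norm_eq_of_mem_actionTorus hw]
    exact (hδ.norm_symm_le _ (by linarith)).trans (by linarith)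
  have h2 : ‖e.symm (γ s) - w‖ ≤ ε := hwd.trans (le_trans (by gcongr; exact hs.2) hb)
  have h3 : ‖e.symm (γ s)‖ ≤ 3 * ε := by
    have := norm_add_le (e.symm (γ s) - w) w
    rw [sub_add_cancel] at this
    linarith
  have h4 := hδ.norm_le (e.symm (γ s)) (by linarith)
  rw [Homeomorph.apply_symm_apply, hsa] at h4
  linarith

/-- Stability estimate for orbits parametrized by an interval around the initial time. -/
theorem stability_estimate {H R : Phase n → ℝ} {Φ : MvPolynomial (Fin n) ℝ}
    {e : Phase n ≃ₜ Phase n} (he : IsGlobalCanonical e)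
    (hR : ∀ z, H (e z) = MvPolynomial.eval (fun j => action j z) Φ + R z)
    {N : ℕ} {K L δ : ℝ} (hK : 0 ≤ K) (hL : 0 ≤ L) (hδ : IsControlRadius H R e N K L δ)
    {ε : ℝ} (hε : 0 < ε) (hεδ : 14 * ε < δ) {J : Set ℝ} (hJ : J.OrdConnected) (hJ0 : 0 ∈ J)
    {z : ℝ → Phase n} (hcont : ContinuousOn z J) (h0 : ‖z 0‖ ≤ ε)
    (hz : ∀ t ∈ J, ‖z t‖ ≤ 7 * ε → HasDerivWithinAt z (hamVectorField H (z t)) J t)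
    {t : ℝ} (ht : t ∈ J) (hb : n * (2 * (K * (14 * ε) ^ N)) * |t| ≤ ε) :
    ‖z t‖ < 7 * ε ∧ ∃ w ∈ actionTorus (fun j => action j (e.symm (z 0))), ‖w‖ ≤ 2 * ε ∧
      ‖z t - e w‖ ≤ L * (n * (2 * (K * (14 * ε) ^ N)) * |t|) := by
  -- Negative times are reduced to positive ones by the substitution s ↦ c s with c = ±1.
  obtain ⟨c, hc, hct⟩ : ∃ c : ℝ, |c| ≤ 1 ∧ c * |t| = t := by
    rcases le_total 0 t with h | h
    · exact ⟨1, by simp, by rw [abs_of_nonneg h, one_mul]⟩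
    · exact ⟨-1, by simp, by rw [abs_of_nonpos h]; ring⟩
  have hmaps : Set.MapsTo (fun s => c * s) (Set.Icc 0 |t|) J := by
    intro s hs
    have h1 : c * s ∈ Set.uIcc 0 t := by
      rcases eq_or_lt_of_le (abs_nonneg t) with h | h
      · have : s = 0 := le_antisymm (hs.2.trans h.ge) hs.1
        simp [this]
      · have h2 : c * s = (s / |t|) * t := by
          rw [← hct]
          simp only [abs_mul, abs_abs]
          have : |c| = 1 := by
            have h3 : |c| * |t| = 1 * |t| := by
              conv_rhs => rw [← hct, abs_mul, abs_abs, one_mul]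
            exact mul_right_cancel₀ h.ne' h3
          rw [this]
          field_simp
        have h3 : s / |t| ∈ Set.Icc (0 : ℝ) 1 :=
          ⟨div_nonneg hs.1 h.le, (div_le_one h).2 hs.2⟩
        rw [h2]
        rcases le_total 0 t with h4 | h4
        · rw [Set.uIcc_of_le h4]
          exact ⟨mul_nonneg h3.1 h4, by nlinarith [h3.2]⟩
        · rw [Set.uIcc_of_ge h4]
          exact ⟨by nlinarith [h3.2], mul_nonpos_of_nonneg_of_nonpos h3.1 h4⟩
    exact hJ.uIcc_subset hJ0 ht h1
  set γ : ℝ → Phase n := fun s => z (c * s) with hγdef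
  have hγ0 : γ 0 = z 0 := by simp [γ]
  have hγt : γ |t| = z t := by simp [γ, hct]
  have hγc : ContinuousOn γ (Set.Icc 0 |t|) := hcont.comp (by fun_prop) hmaps
  have hγ : ∀ s ∈ Set.Icc 0 |t|, ‖γ s‖ ≤ 7 * ε →
      HasDerivWithinAt γ (c • hamVectorField H (γ s)) (Set.Icc 0 |t|) s := by
    intro s hs hle
    have h1 : HasDerivWithinAt (fun s => c * s) c (Set.Icc 0 |t|) s := by
      simpa using ((hasDerivAt_id s).const_mul c).hasDerivWithinAt
    exact (hz _ (hmaps hs) hle).scomp s h1 hmaps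
  have hright : |t| ∈ Set.Icc 0 |t| := ⟨abs_nonneg t, le_rfl⟩
  have hlt : ∀ s ∈ Set.Icc 0 |t|, ‖γ s‖ < 7 * ε := fun s hs =>
    norm_lt_of_short_time he hR hK hδ hε hεδ hc hb hγc (by rwa [hγ0]) hγ hs
  obtain ⟨w, hw, hwd⟩ := exists_torus_point_of_forall_norm_le he hR hK hδ hεδ hc
    (fun s hs => hγ s hs (hlt s hs).le) (fun s hs => (hlt s hs).le) hright
  rw [hγ0] at hw
  rw [hγt] at hwd
  have hzt : ‖z t‖ < 7 * ε := hγt ▸ hlt _ hright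
  have hwn : ‖w‖ ≤ 2 * ε := by
    rw [norm_eq_of_mem_actionTorus hw]
    exact (hδ.norm_symm_le _ (by linarith)).trans (by linarith)
  refine ⟨hzt, w, hw, hwn, ?_⟩
  have hs1 := hδ.norm_symm_le (z t) (by linarith)
  have h := hδ.lipschitz (e.symm (z t)) w (by linarith) (by linarith)
  rw [Homeomorph.apply_symm_apply] at h
  exact h.trans (by gcongr)

end Dynamics

/-! ### Existence of solutions by cutting off the vector field. -/

section Existence

variable {n : ℕ}

theorem contDiffAt_hamVectorField {H : Phase n → ℝ} {z : Phase n}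
    (hH : ContDiffAt ℝ 2 H z) : ContDiffAt ℝ 1 (hamVectorField H) z := by
  have h1 : ∀ v, ContDiffAt ℝ 1 (fun z => fderiv ℝ H z v) z := fun v =>
    (hH.fderiv_right (m := 1) (by norm_num)).clm_apply contDiffAt_const
  rw [contDiffAt_euclidean]
  rintro (j | j)
  · exact h1 _
  · exact (h1 _).neg

/-- Curves which solve the Hamiltonian system as long as they stay in a small ball exist for all
times. -/
theorem exists_cutoff_solution {M : Set (Phase n)} (hM : IsOpen M) (h0 : 0 ∈ M) {H : Phase n → ℝ}
    (hH : ContDiffOn ℝ (⊤ : ℕ∞) H M) :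
    ∃ ρ : ℝ, 0 < ρ ∧ Metric.ball 0 ρ ⊆ M ∧ ∀ (z₀ : Phase n) (T : ℝ), 0 ≤ T →
      ∃ z : ℝ → Phase n, z 0 = z₀ ∧ ContinuousOn z (Set.Icc (-T) T) ∧
        ∀ t ∈ Set.Icc (-T) T, ‖z t‖ < ρ →
          HasDerivWithinAt z (hamVectorField H (z t)) (Set.Icc (-T) T) t := by
  obtain ⟨δ, hδ, hball⟩ := Metric.isOpen_iff.1 hM 0 h0
  -- The cut-off field equals the Hamiltonian field on the ball of radius δ/4 and has compact
  -- support in M, hence it is globally bounded and Lipschitz.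
  let χ : ContDiffBump (0 : Phase n) := ⟨δ / 4, δ / 2, by positivity, by linarith⟩
  have htsupp : tsupport χ ⊆ M := by
    rw [χ.tsupport_eq]
    exact (Metric.closedBall_subset_ball (by change δ / 2 < δ; linarith)).trans hball
  let X : Phase n → Phase n := fun z => χ z • hamVectorField H z
  have hX : ContDiff ℝ 1 X := by
    rw [contDiff_iff_contDiffAt]
    intro z
    by_cases hz : z ∈ M
    · have hHz : ContDiffAt ℝ 2 H z :=
        (hH.contDiffAt (hM.mem_nhds hz)).of_le (WithTop.coe_le_coe.2 (le_top : (2 : ℕ∞) ≤ ⊤))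
      exact χ.contDiff.contDiffAt.smul (contDiffAt_hamVectorField hHz)
    · have hz' : z ∉ tsupport χ := fun h => hz (htsupp h)
      refine (contDiffAt_const (c := (0 : Phase n))).congr_of_eventuallyEq ?_
      filter_upwards [notMem_tsupport_iff_eventuallyEq.1 hz'] with y hy
      simp [X, hy]
  have hXc : HasCompactSupport X := χ.hasCompactSupport.smul_right
  obtain ⟨K, hK⟩ := hX.lipschitzWith_of_hasCompactSupport hXc one_ne_zero
  obtain ⟨B, hB⟩ := hXc.exists_bound_of_continuous hX.continuous
  lift B to NNReal using (norm_nonneg _).trans (hB 0)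
  refine ⟨δ / 4, by positivity, (Metric.ball_subset_ball (by linarith)).trans hball,
    fun z₀ T hT => ?_⟩
  -- With speed at most B, a ball of radius B T cannot be left before time T, so Picard–Lindelöf
  -- applies on the whole interval.
  have hpl : IsPicardLindelof (fun _ => X) (tmin := -T) (tmax := T) ⟨0, by simpa using hT⟩ z₀
      (B * T.toNNReal) 0 B K :=
    { lipschitzOnWith := fun t _ => hK.lipschitzOnWith
      continuousOn := fun x _ => continuousOn_const
      norm_le := fun t _ x _ => hB x
      mul_max_le := by simp [Real.coe_toNNReal _ hT] }
  obtain ⟨z, hz0, hz⟩ := hpl.exists_eq_forall_mem_Icc_hasDerivWithinAt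
    (Metric.mem_closedBall_self (by simp))
  refine ⟨z, hz0, fun t ht => (hz t ht).continuousWithinAt, fun t ht hlt => ?_⟩
  have h1 : χ (z t) = 1 := χ.one_of_mem_closedBall (by
    rw [mem_closedBall_zero_iff]
    exact hlt.le)
  simpa [X, h1] using hz t ht

end Existence

/-! ### The normalizing chart inside M and the final estimates. -/

section Main

variable {n : ℕ}

/-- The restriction of a global homeomorphism to the points of `M` that are mapped into `M`. -/
noncomputable def restrictTo (e : Phase n ≃ₜ Phase n) {M : Set (Phase n)} (hM : IsOpen M) :
    OpenPartialHomeomorph (Phase n) (Phase n) :=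
  e.toOpenPartialHomeomorph.restrOpen (M ∩ e ⁻¹' M) (hM.inter (hM.preimage e.continuous))

section

variable (e : Phase n ≃ₜ Phase n) {M : Set (Phase n)} (hM : IsOpen M)

theorem restrictTo_apply (z : Phase n) : restrictTo e hM z = e z := rfl

theorem restrictTo_symm_apply (z : Phase n) : (restrictTo e hM).symm z = e.symm z := rfl

theorem mem_restrictTo_source {z : Phase n} :
    z ∈ (restrictTo e hM).source ↔ z ∈ M ∧ e z ∈ M := by
  simp [restrictTo]

theorem mem_restrictTo_target {z : Phase n} :
    z ∈ (restrictTo e hM).target ↔ e.symm z ∈ M ∧ z ∈ M := by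
  simp [restrictTo]

end

theorem isAnalyticCanonical_restrictTo {e : Phase n ≃ₜ Phase n} (he : IsGlobalCanonical e)
    {M : Set (Phase n)} (hM : IsOpen M) : IsAnalyticCanonical (restrictTo e hM) where
  analytic := he.analytic.mono (Set.subset_univ _)
  analytic_symm := he.analytic_symm.mono (Set.subset_univ _)
  bracket F G hF hG z hz := by
    have hmem := (restrictTo e hM).open_target.mem_nhds ((restrictTo e hM).map_source hz)
    have hde : DifferentiableAt ℝ e z := he.contDiff.differentiable one_ne_zero z
    have hd : ∀ {F : Phase n → ℝ}, ContDiffOn ℝ (⊤ : ℕ∞) F (restrictTo e hM).target →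
        fderiv ℝ (F ∘ restrictTo e hM) z = (fderiv ℝ F (e z)).comp (fderiv ℝ e z) := fun hF =>
      fderiv_comp z ((hF.contDiffAt hmem).differentiableAt (by simp)) hde
    rw [poissonBracket_eq_poissonForm, poissonBracket_eq_poissonForm, hd hF, hd hG, he.poisson z,
      restrictTo_apply]

theorem isNormalizing_restrictTo {M : Set (Phase n)} (hM : IsOpen M) (h0 : 0 ∈ M)
    {ω : Fin n → ℝ} {P : Phase n → ℝ} {r N : ℕ} (hrN : r ≤ N) {e : Phase n ≃ₜ Phase n}
    (he : IsGlobalCanonical e) {Z : ℕ → MvPolynomial (Fin n) ℝ}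
    (hZdeg : ∀ m, 2 * (Z m).totalDegree ≤ m)
    (hZmem : ∀ m, (fun z => MvPolynomial.eval (fun j => action j z) (Z m)) ∈ powerSpan (Phase n) m)
    (hZO : (fun z => (harmonic ω + P) (e z) - harmonic ω z - ∑ m ∈ Finset.range (N + 1),
      MvPolynomial.eval (fun j => action j z) (Z m)) =O[𝓝 0] fun z => ‖z‖ ^ (N + 1)) :
    IsNormalizing M ω P r (restrictTo e hM) where
  zero_mem_source := by rw [mem_restrictTo_source, he.map_zero]; exact ⟨h0, h0⟩
  zero_mem_target := by
    rw [mem_restrictTo_target, show e.symm 0 = 0 by rw [Homeomorph.symm_apply_eq, he.map_zero]]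
    exact ⟨h0, h0⟩
  source_subset z hz := ((mem_restrictTo_source e hM).1 hz).1
  target_subset z hz := ((mem_restrictTo_target e hM).1 hz).2
  canonical := isAnalyticCanonical_restrictTo he hM
  near_id := he.near_id
  normal_form := by
    -- The action terms of degrees r + 1 to N are not kept in Z: they belong to the order r
    -- remainder.
    refine ⟨∑ m ∈ Finset.range (r + 1), Z m, ?_, ?_⟩
    · have h : (∑ m ∈ Finset.range (r + 1), Z m).totalDegree ≤ r / 2 := by
        refine MvPolynomial.totalDegree_finsetSum_le fun m hm => ?_
        have h1 := hZdeg m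
        have h2 := Finset.mem_range.1 hm
        omega
      omega
    · have h1 := hZO.trans (isBigO_norm_pow_of_le (show r + 1 ≤ N + 1 by omega))
      have h2 : (fun z => ∑ m ∈ Finset.Ico (r + 1) (N + 1),
          MvPolynomial.eval (fun j => action j z) (Z m)) =O[𝓝 0]
          fun z : Phase n => ‖z‖ ^ (r + 1) :=
        IsBigO.fun_sum fun m hm => (isBigO_of_mem_powerSpan (hZmem m) _).trans
          (isBigO_norm_pow_of_le (Finset.mem_Ico.1 hm).1)
      refine (h1.add h2).congr_left fun z => ?_
      rw [map_sum, restrictTo_apply, ← Finset.sum_range_add_sum_Ico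
        (fun m => MvPolynomial.eval (fun j => action j z) (Z m)) (show r + 1 ≤ N + 1 by omega)]
      ring

theorem harmonic_eq_eval (ω : Fin n → ℝ) (z : Phase n) :
    harmonic ω z = MvPolynomial.eval (fun j => action j z)
      (∑ j, MvPolynomial.C (ω j) * MvPolynomial.X j) := by
  simp [harmonic]

/-- With the conventions 0^s = 0 for s ≠ 0 and 1/0 = 0, the time horizon attached to the equilibrium
is at most 1. -/
theorem one_div_zero_rpow_le (s : ℝ) : 1 / (0 : ℝ) ^ s ≤ 1 := by
  rcases eq_or_ne s 0 with rfl | hs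
  · simp
  · simp [Real.zero_rpow hs]

theorem one_div_rpow_le {ε s : ℝ} {k : ℕ} (hε : 0 < ε) (hε1 : ε ≤ 1) (hs : s ≤ k) :
    1 / ε ^ s ≤ 1 / ε ^ k := by
  have h : ε ^ (k : ℝ) ≤ ε ^ s := Real.rpow_le_rpow_of_exponent_ge hε hε1 hs
  rw [Real.rpow_natCast] at h
  exact one_div_le_one_div_of_le (by positivity) h

end Main

end Birkhoff

open Birkhoff

theorem mainTheorem8 {n : ℕ} (M : Set (Birkhoff.Phase n)) (hM : IsOpen M) (h0 : 0 ∈ M)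
    (ω : Fin n → ℝ) (hω : Birkhoff.NonResonant ω)
    (P : Birkhoff.Phase n → ℝ) (hP : ContDiffOn ℝ (⊤ : ℕ∞) P M)
    (hP3 : P =O[𝓝 0] fun z => ‖z‖ ^ 3)
    (r : ℕ) (hr : 3 ≤ r) :
    ∃ τ : OpenPartialHomeomorph (Birkhoff.Phase n) (Birkhoff.Phase n),
      Birkhoff.IsNormalizing M ω P r τ ∧
      ∃ ε₀ : ℝ, 0 < ε₀ ∧ ∃ C : ℝ, 0 < C ∧
        ∀ z₀ : Birkhoff.Phase n, ‖z₀‖ < ε₀ →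
          z₀ ∈ τ.target ∧
          Birkhoff.actionTorus (fun j => Birkhoff.action j (τ.symm z₀)) ⊆ τ.source ∧
          ∀ r₁ r₂ : ℝ, 0 ≤ r₁ → r₁ + r₂ = r + 1 →
            (∃ z : ℝ → Birkhoff.Phase n, z 0 = z₀ ∧
              Birkhoff.IsSolutionOn M (Birkhoff.harmonic ω + P)
                (Set.Icc (-(1 / ‖z₀‖ ^ r₂)) (1 / ‖z₀‖ ^ r₂)) z) ∧
            ∀ (J : Set ℝ) (z : ℝ → Birkhoff.Phase n), J.OrdConnected → 0 ∈ J → z 0 = z₀ →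
              Birkhoff.IsSolutionOn M (Birkhoff.harmonic ω + P) J z →
              ∀ t ∈ J, |t| ≤ 1 / ‖z₀‖ ^ r₂ →
                Metric.infDist (z t) (Birkhoff.normalizedTorus τ z₀) ≤ C * ‖z₀‖ ^ r₁ := by
  set H : Phase n → ℝ := harmonic ω + P with hHdef
  have hHM : ContDiffOn ℝ (⊤ : ℕ∞) H M := (contDiff_harmonic ω).contDiffOn.add hP
  have hH : ContDiffAt ℝ (⊤ : ℕ∞) H 0 := hHM.contDiffAt (hM.mem_nhds h0)
  have hH3 : (fun z => H z - harmonic ω z) =O[𝓝 0] fun z => ‖z‖ ^ 3 := by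
    simpa [hHdef] using hP3
  -- With order r + 3, dR is O(ε^(r+3)) and the drift up to time ε^(-(r+1)) is O(ε²), which is at
  -- most ε for small ε. This serves all r₁ ≥ 0 at once, including r₁ = 0, where a drift of order
  -- ε^(r₁) would not close the bootstrap.
  obtain ⟨e, he, -, Z, hZdeg, hZmem, hZO⟩ := exists_normalization hω hH hH3 (r + 3) (by omega)
  set Φ : MvPolynomial (Fin n) ℝ := (∑ j, MvPolynomial.C (ω j) * MvPolynomial.X j)
    + ∑ m ∈ Finset.range (r + 3 + 1), Z m
  set R : Phase n → ℝ := fun z => H (e z) - MvPolynomial.eval (fun j => action j z) Φ with hRdef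
  have hR : ∀ z, H (e z) = MvPolynomial.eval (fun j => action j z) Φ + R z := fun z => by
    rw [hRdef]
    ring
  have hRO : R =O[𝓝 0] fun z => ‖z‖ ^ (r + 3 + 1) := by
    refine hZO.congr_left fun z => ?_
    simp only [hRdef, Φ, map_add]
    rw [← harmonic_eq_eval, map_sum]
    ring
  have hRs : ContDiffAt ℝ (⊤ : ℕ∞) R 0 := by
    refine ContDiffAt.sub (ContDiffAt.comp 0 ?_ he.contDiff.contDiffAt)
      (contDiff_eval_action Φ).contDiffAt
    rwa [he.map_zero]
  obtain ⟨K, L, δ₁, hK, hL, hδ₁⟩ := exists_isControlRadius he hH hRs hRO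
  obtain ⟨ρ, hρ, hρM, hex⟩ := exists_cutoff_solution hM h0 hHM
  have hnorm := isNormalizing_restrictTo hM h0 (show r ≤ r + 3 by omega) he hZdeg hZmem hZO
  set τ := restrictTo e hM with hτ
  obtain ⟨δ₂, hδ₂, hsource⟩ := Metric.isOpen_iff.1 τ.open_source 0 hnorm.zero_mem_source
  obtain ⟨δ₃, hδ₃, htarget⟩ := Metric.isOpen_iff.1 τ.open_target 0 hnorm.zero_mem_target
  obtain ⟨δ, hδ, hδρ, hδ2, hδ3⟩ : ∃ δ, IsControlRadius H R e (r + 3) K L δ ∧ δ ≤ ρ ∧ δ ≤ δ₂ ∧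
      δ ≤ δ₃ := by
    have := hδ₁.pos
    refine ⟨min (min δ₁ ρ) (min δ₂ δ₃), hδ₁.mono (by positivity) ?_, ?_, ?_, ?_⟩
    exacts [(min_le_left _ _).trans (min_le_left _ _), (min_le_left _ _).trans (min_le_right _ _),
      (min_le_right _ _).trans (min_le_left _ _), (min_le_right _ _).trans (min_le_right _ _)]
  have hδpos := hδ.pos
  set A : ℝ := n * (2 * (K * 14 ^ (r + 3))) with hA
  have hA0 : 0 ≤ A := by positivity
  have hAε : ∀ ε s : ℝ, n * (2 * (K * (14 * ε) ^ (r + 3))) * s = A * ε ^ (r + 3) * s :=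
    fun ε s => by rw [hA]; ring
  obtain ⟨ε₀, hε₀, hε₀1, hε₀δ, hε₀A⟩ : ∃ ε₀ : ℝ, 0 < ε₀ ∧ ε₀ ≤ 1 ∧ 14 * ε₀ ≤ δ ∧ A * ε₀ ≤ 1 := by
    refine ⟨min 1 (min (δ / 14) (A + 1)⁻¹), by positivity, min_le_left _ _, ?_, ?_⟩
    · have : min 1 (min (δ / 14) (A + 1)⁻¹) ≤ δ / 14 := (min_le_right _ _).trans (min_le_left _ _)
      linarith
    · calc A * min 1 (min (δ / 14) (A + 1)⁻¹) ≤ A * (A + 1)⁻¹ := by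
            gcongr
            exact (min_le_right _ _).trans (min_le_right _ _)
        _ ≤ 1 := by
            rw [← div_eq_mul_inv, div_le_one (by positivity)]
            linarith
  have htime : ∀ ε t : ℝ, 0 < ε → ε < ε₀ → |t| ≤ 1 / ε ^ (r + 1) →
      A * ε ^ (r + 3) * |t| ≤ ε := by
    intro ε t hε hεε₀ ht
    calc A * ε ^ (r + 3) * |t| ≤ A * ε ^ (r + 3) * (1 / ε ^ (r + 1)) := by gcongr
      _ = A * ε * ε := by
        field_simp
        ring
      _ ≤ A * ε₀ * ε := by gcongr
      _ ≤ 1 * ε := by gcongr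
      _ = ε := one_mul ε
  have hstab : ∀ ε, 0 < ε → ε < ε₀ → ∀ (J : Set ℝ) (z : ℝ → Phase n), J.OrdConnected → 0 ∈ J →
      ContinuousOn z J → ‖z 0‖ ≤ ε →
      (∀ t ∈ J, ‖z t‖ ≤ 7 * ε → HasDerivWithinAt z (hamVectorField H (z t)) J t) →
      ∀ t ∈ J, |t| ≤ 1 / ε ^ (r + 1) →
      ‖z t‖ < 7 * ε ∧ ∃ w ∈ actionTorus (fun j => action j (e.symm (z 0))), ‖w‖ ≤ 2 * ε ∧
        ‖z t - e w‖ ≤ L * (A * ε ^ (r + 3) * |t|) := by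
    intro ε hε hεε₀ J z hJ hJ0 hc hz0 hz t ht htle
    rw [← hAε]
    refine stability_estimate he hR hK hL hδ hε (by linarith) hJ hJ0 hc hz0 hz ht ?_
    rw [hAε]
    exact htime ε t hε hεε₀ htle
  -- Since r₁ ≥ 0 forces r₂ ≤ r + 1, the single horizon ε^(-(r+1)) covers every admissible r₂. At
  -- the equilibrium the norm is replaced by an arbitrary positive scale.
  have hscale : ∀ (z₀ : Phase n) (s : ℝ), ‖z₀‖ < ε₀ → s ≤ r + 1 → ∃ ε, 0 < ε ∧ ε < ε₀ ∧
      ‖z₀‖ ≤ ε ∧ 1 / ‖z₀‖ ^ s ≤ 1 / ε ^ (r + 1) := by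
    intro z₀ s hz₀ hs
    rcases eq_or_ne z₀ 0 with rfl | hne
    · refine ⟨ε₀ / 2, by positivity, by linarith, by rw [norm_zero]; positivity, ?_⟩
      rw [norm_zero]
      refine (one_div_zero_rpow_le s).trans ?_
      rw [le_div_iff₀ (by positivity), one_mul]
      exact pow_le_one₀ (by positivity) (by linarith)
    · exact ⟨‖z₀‖, norm_pos_iff.2 hne, hz₀, le_rfl,
        one_div_rpow_le (norm_pos_iff.2 hne) (hz₀.le.trans hε₀1) (by push_cast; exact hs)⟩
  refine ⟨τ, hnorm, ε₀, hε₀, L * A + 1, by positivity, fun z₀ hz₀ => ?_⟩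
  have hz₀δ : ‖z₀‖ < δ := by linarith [norm_nonneg z₀]
  have hz₀t : z₀ ∈ τ.target := htarget (mem_ball_zero_iff.2 (hz₀δ.trans_le hδ3))
  have htorus : actionTorus (fun j => action j (τ.symm z₀)) ⊆ τ.source := by
    intro x hx
    refine hsource (mem_ball_zero_iff.2 ?_)
    have h1 : ‖x‖ = ‖e.symm z₀‖ := norm_eq_of_mem_actionTorus hx
    have h2 := hδ.norm_symm_le z₀ hz₀δ
    linarith [norm_nonneg z₀]
  refine ⟨hz₀t, htorus, fun r₁ r₂ hr₁ hr₁₂ => ⟨?_, ?_⟩⟩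
  · set T : ℝ := 1 / ‖z₀‖ ^ r₂ with hT
    have hT0 : 0 ≤ T := by positivity
    obtain ⟨ε, hε, hεε₀, hzε, hTε⟩ := hscale z₀ r₂ hz₀ (by linarith)
    obtain ⟨z, hz0, hzc, hz⟩ := hex z₀ T hT0
    -- The bootstrap needs the equation only while the norm is at most 7ε, below the cut-off radius
    -- ρ, so it applies to the cut-off curve and shows that it is a genuine solution.
    have hsmall : ∀ t ∈ Set.Icc (-T) T, ‖z t‖ < ρ := fun t ht => by
      have h := (hstab ε hε hεε₀ (Set.Icc (-T) T) z Set.ordConnected_Icc (by simpa using hT0) hzc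
        (by rwa [hz0]) (fun s hs hle => hz s hs (by linarith)) t ht
        ((abs_le.2 ht).trans hTε)).1
      linarith
    exact ⟨z, hz0, fun t ht =>
      ⟨hρM (mem_ball_zero_iff.2 (hsmall t ht)), hz t ht (hsmall t ht)⟩⟩
  · intro J z hJ hJ0 hz0 hz t ht htle
    have hzc : ContinuousOn z J := fun s hs => (hz s hs).2.continuousWithinAt
    rcases eq_or_ne z₀ 0 with rfl | hne
    -- Stability at arbitrarily small positive scales forces any solution starting at the
    -- equilibrium to stay there.
    · have hzt : z t = 0 := by
        rw [← norm_le_zero_iff]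
        refine le_of_forall_pos_le_add fun η hη => ?_
        have hmin : 0 < min (ε₀ / 2) (η / 7) := by positivity
        have hm1 : min (ε₀ / 2) (η / 7) ≤ ε₀ / 2 := min_le_left _ _
        have hm2 : min (ε₀ / 2) (η / 7) ≤ η / 7 := min_le_right _ _
        have h := (hstab (min (ε₀ / 2) (η / 7)) hmin (by linarith) J z hJ hJ0 hzc
          (by rw [hz0, norm_zero]; exact hmin.le) (fun s hs _ => (hz s hs).2) t ht ?_).1
        · linarith
        · rw [norm_zero] at htle
          refine (htle.trans (one_div_zero_rpow_le r₂)).trans ?_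
          rw [le_div_iff₀ (by positivity), one_mul]
          exact pow_le_one₀ hmin.le (by linarith)
      have hmem : 0 ∈ normalizedTorus τ 0 := ⟨hz₀t, fun j => rfl⟩
      rw [hzt, Metric.infDist_zero_of_mem hmem]
      positivity
    · have hpos : 0 < ‖z₀‖ := norm_pos_iff.2 hne
      have hle1 : ‖z₀‖ ≤ 1 := hz₀.le.trans hε₀1
      obtain ⟨-, w, hw, -, hwd⟩ := hstab ‖z₀‖ hpos hz₀ J z hJ hJ0 hzc (by rw [hz0])
        (fun s hs _ => (hz s hs).2) t ht
        (htle.trans (one_div_rpow_le hpos hle1 (by push_cast; linarith)))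
      rw [hz0] at hw
      have hmem : e w ∈ normalizedTorus τ z₀ := by
        refine ⟨τ.map_source (htorus hw), fun j => ?_⟩
        rw [hτ, restrictTo_symm_apply, Homeomorph.symm_apply_apply]
        exact hw j
      refine (Metric.infDist_le_dist_of_mem hmem).trans ?_
      rw [dist_eq_norm]
      refine hwd.trans ?_
      -- Two of the r + 3 powers are surplus here: ε^(r+1) ε^(-r₂) is already ε^(r₁).
      have hpow : ‖z₀‖ ^ (r + 3) * |t| ≤ ‖z₀‖ ^ r₁ := by
        calc ‖z₀‖ ^ (r + 3) * |t| ≤ ‖z₀‖ ^ (r + 1) * (1 / ‖z₀‖ ^ r₂) := by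
              gcongr ?_ * ?_
              · exact pow_le_pow_of_le_one hpos.le hle1 (by omega)
          _ = ‖z₀‖ ^ r₁ := by
              rw [one_div, ← Real.rpow_neg hpos.le, ← Real.rpow_natCast, ← Real.rpow_add hpos]
              congr 1
              push_cast
              linarith
      calc L * (A * ‖z₀‖ ^ (r + 3) * |t|) = L * A * (‖z₀‖ ^ (r + 3) * |t|) := by ring
        _ ≤ L * A * ‖z₀‖ ^ r₁ := by gcongr
        _ ≤ (L * A + 1) * ‖z₀‖ ^ r₁ := by
            gcongr
            linarith
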